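/- Let $d\ge 1$ and $n\ge 0$ be integers and $\mu\in\mathbb R^d$. Put $\mu^*=\max_i\mu_i$ and $\Delta_i=\mu^*-\mu_i$. In round $t=1,\dots,n$ a learner chooses an arm $I_t\in\{1,\dots,d\}$ and receives a reward $X_t$ which, given $I_1,X_1,\dots,I_{t-1},X_{t-1},I_t$, has law $\mathcal N(\mu_{I_t},1)$. The regret is $R_\mu(n)=\mathbb E\bigl[\sum_{t=1}^n(\mu^*-\mu_{I_t})\bigr]$. Let $T_i(t)=\#\{s\le t: I_s=i\}$ and $\hat\mu_i(t)=\frac1{T_i(t)}\sum_{s\le t,\,I_s=i}X_s$. For $\nu\in\mathbb R$, $\sigma^2\ge 0$ and an integer $m\ge 1$ let $\theta\sim\mathcal N(\nu,\sigma^2)$ and, given $\theta$, let $Y_1,Y_2,\dots$ be independent with law $\mathcal N(\theta,1)$. The (finite-horizon) Gittins index is $$\gamma(\nu,\sigma^2,m)=\max\Bigl\{\gamma\in\mathbb R:\ \sup_{1\le\tau\le m}\mathbb E[(\theta-\gamma)\tau]\ge 0\Bigr\},$$ where the supremum is over stopping times $\tau$ of the filtration generated by $Y_1,Y_2,\dots$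 with $1\le\tau\le m$. The Gittins index strategy with a flat improper Gaussian prior and horizon $n$ chooses $I_t=t$ in the rounds $t\le\min\{d,n\}$, and in the rounds $d<t\le n$ it chooses $$I_t\in\operatorname*{arg\,max}_i\ \gamma\bigl(\hat\mu_i(t-1),\,T_i(t-1)^{-1},\,n-t+1\bigr),$$ with ties broken arbitrarily. There are universal constants $c,c'>0$ such that for all $d$, $n$ and $\mu$ the regret of this strategy satisfies $$R_\mu(n)\le c\sum_{i:\Delta_i>0}\Bigl(\frac{\log n}{\Delta_i}+\Delta_i\Bigr)\qquad\text{and}\qquad R_\mu(n)\le c'\Bigl(\sqrt{dn\log n}+\sum_{i=1}^d\Delta_i\Bigr)$$ (for $n=0$ both sides are read with $\log 0=0$). -/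

import Mathlib

open MeasureTheory ProbabilityTheory
open scoped NNReal

noncomputable section

namespace GittinsBandit

/-! ### The Gittins index of a Gaussian arm -/

/-- Sample space of a single arm: the random mean, and the noise of its successive plays. -/
abbrev ArmSpace : Type := ℝ × (ℕ → ℝ)

/-- The mean has law `N(ν, v)` (with variance `v`); the noise variables are i.i.d. `N(0, 1)` and
independent of the mean. -/
def armMeasure (ν : ℝ) (v : ℝ≥0) : Measure ArmSpace :=
  (gaussianReal ν v).prod (Measure.infinitePi fun _ : ℕ => gaussianReal 0 1)

/-- The observation `Y_{s+1}` of the arm. Conditionally on the mean `θ`, the observations are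
independent with law `N(θ, 1)`. -/
def armObs (s : ℕ) (ω : ArmSpace) : ℝ := ω.1 + ω.2 s

theorem measurable_armObs (s : ℕ) : Measurable (armObs s) :=
  measurable_fst.add ((measurable_pi_apply s).comp measurable_snd)

/-- The filtration generated by the observations: at time `t` it is `σ(Y_1, …, Y_t)`. -/
def armFiltration : Filtration ℕ (inferInstance : MeasurableSpace ArmSpace) where
  seq t := ⨆ s : ℕ, ⨆ _ : s < t, MeasurableSpace.comap (armObs s) inferInstance
  mono' _ _ h := iSup_mono fun _ => iSup_mono' fun hs => ⟨lt_of_lt_of_le hs h, le_rfl⟩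
  le' _ := iSup_le fun s => iSup_le fun _ => (measurable_armObs s).comap_le

/-- Stopping times `τ` of the filtration of the observations with `1 ≤ τ ≤ m`. -/
def IsArmStoppingTime (m : ℕ) (τ : ArmSpace → ℕ) : Prop :=
  IsStoppingTime armFiltration (fun ω => (τ ω : WithTop ℕ)) ∧ ∀ ω, 1 ≤ τ ω ∧ τ ω ≤ m

/-- `sup_{1 ≤ τ ≤ m} E[(μ - γ) τ]`, where `μ ∼ N(ν, v)` is the mean of the arm. For `m ≥ 1` this is
the supremum of a nonempty bounded set of real numbers. -/
def stoppingValue (ν : ℝ) (v : ℝ≥0) (m : ℕ) (γ : ℝ) : ℝ :=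
  sSup {x : ℝ | ∃ τ : ArmSpace → ℕ, IsArmStoppingTime m τ ∧
    x = ∫ ω, (ω.1 - γ) * (τ ω : ℝ) ∂(armMeasure ν v)}

/-- The Gittins index `γ(ν, v, m) = max {γ | sup_{1 ≤ τ ≤ m} E[(μ - γ) τ] ≥ 0}` of an arm with
posterior mean `ν`, posterior variance `v` and `m` remaining rounds. For `m ≥ 1` the maximum is
attained, since the stopping value is continuous and strictly decreasing in `γ`, with limits `±∞`. -/
def gittinsIndex (ν : ℝ) (v : ℝ≥0) (m : ℕ) : ℝ :=
  sSup {γ : ℝ | 0 ≤ stoppingValue ν v m γ}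

/-! ### The bandit

Rounds are numbered from `0`: the arm `I t` and the reward `X t` with `t < n` are those of the
`(t + 1)`-th round. -/

variable {Ω : Type*} {d : ℕ}

/-- The optimal mean `μ* = max_i μ_i`. -/
def optMean (μ : Fin d → ℝ) : ℝ := ⨆ i, μ i

/-- The gap `Δ_i = μ* - μ_i`. -/
def gap (μ : Fin d → ℝ) (i : Fin d) : ℝ := optMean μ - μ i

/-- The law of a reward, given the arm that is played. -/
def rewardKernel (μ : Fin d → ℝ) : Kernel (Fin d) ℝ :=
  Kernel.ofFunOfCountable fun i => gaussianReal (μ i) 1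

/-- The arms and rewards of the first `t` rounds. -/
def history (I : ℕ → Ω → Fin d) (X : ℕ → Ω → ℝ) (t : ℕ) (ω : Ω) : Fin t → Fin d × ℝ :=
  fun s => (I s ω, X s ω)

/-- `I` and `X` are the arms and rewards of a learner in the Gaussian bandit with means `μ` during
`n` rounds: given the past and the arm chosen in the current round, the reward has law
`N(μ_i, 1)`, where `i` is that arm. (The choice of the arm may use external randomness.) -/
structure IsInteraction [MeasurableSpace Ω] (P : Measure Ω) (μ : Fin d → ℝ) (n : ℕ)
    (I : ℕ → Ω → Fin d) (X : ℕ → Ω → ℝ) : Prop where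
  measurable_arm : ∀ t, Measurable (I t)
  measurable_reward : ∀ t, Measurable (X t)
  reward_law : ∀ t < n, HasCondDistrib (X t) (fun ω => (history I X t ω, I t ω))
    ((rewardKernel μ).prodMkLeft (Fin t → Fin d × ℝ)) P

/-- `T_i(t)`: the number of plays of arm `i` in the first `t` rounds. -/
def armCount (I : ℕ → Ω → Fin d) (i : Fin d) (t : ℕ) (ω : Ω) : ℕ :=
  ((Finset.range t).filter fun s => I s ω = i).card

/-- The empirical mean of arm `i` after the first `t` rounds (used only if `T_i(t) > 0`). -/
def empMean (I : ℕ → Ω → Fin d) (X : ℕ → Ω → ℝ) (i : Fin d) (t : ℕ) (ω : Ω) : ℝ :=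
  (∑ s ∈ (Finset.range t).filter (fun s => I s ω = i), X s ω) / (armCount I i t ω : ℝ)

/-- The index of arm `i` under the flat prior, when `t` of the `n` rounds have been played and
`n - t` rounds remain (the current one included). -/
def flatIndex (n : ℕ) (I : ℕ → Ω → Fin d) (X : ℕ → Ω → ℝ) (i : Fin d) (t : ℕ) (ω : Ω) : ℝ :=
  gittinsIndex (empMean I X i t ω) ((armCount I i t ω : ℝ≥0)⁻¹) (n - t)

/-- The arms are chosen by the Gittins index strategy with the flat Gaussian prior and horizon `n`:
each arm is played once in the first `d` rounds, in their order, and then in every round an arm of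
maximal index is played, ties being broken in any way. -/
def FollowsFlatGittins [MeasurableSpace Ω] (P : Measure Ω) (n : ℕ)
    (I : ℕ → Ω → Fin d) (X : ℕ → Ω → ℝ) : Prop :=
  ∀ᵐ ω ∂P, ∀ t < n,
    (t < d → (I t ω : ℕ) = t) ∧
    (d ≤ t → ∀ j, flatIndex n I X j t ω ≤ flatIndex n I X (I t ω) t ω)

/-- The expected regret `E[∑_{t=1}^n (μ* - μ_{I_t})]`. -/
def regret [MeasurableSpace Ω] (P : Measure Ω) (μ : Fin d → ℝ) (n : ℕ)
    (I : ℕ → Ω → Fin d) : ℝ :=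
  ∫ ω, ∑ t ∈ Finset.range n, (optMean μ - μ (I t ω)) ∂P

end GittinsBandit

end

/-!
Consider an arm with empirical mean `ν` and `T` plays, with `m` rounds to go. Its index is at most
`ν + √(2 log m / T)`, because a stopping time cannot gain more than `m` times the upper tail
of the posterior. It exceeds `ν + x / √T` as soon as `m` is at least a constant times
`exp (x ^ 2 / 2) * x * (T + x ^ 2)`, because the rule that plays until a sequential test rejects the
arm then gains more on large means than it loses on small ones.

By the lower bound, the index of an optimal arm is below `μ* - ε` only if the random walk of its
noise is above a boundary of order `ε T + √(2 T log (m / T))`. The tail probabilities of the walk at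
all times, weighted so that each block `[T, T + T / log (m / T)]` has weight of order `1`, add up to
a superharmonic function that is at least `1` wherever the walk is above the boundary. Its initial
value `O(1 / (m ε ^ 2))` bounds the probability that the index is too small with `m` rounds to go,
and the sum over the rounds is `O(log n / ε ^ 2)`. Take `ε = Δ / 2` for an arm of gap `Δ`: by the
upper bound, any other play of this arm is one of its first `O(log n / Δ ^ 2)` plays or comes with a
large deviation of its empirical mean, so that the expected number of plays is
`O(log n / Δ ^ 2 + 1)`. This gives the first bound on the regret, and the second by Cauchy–Schwarz.
-/

noncomputable section

namespace GittinsBandit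

open Real Set

/-! ### Gaussian estimates -/

lemma integral_exp_mul_gaussianReal (ν : ℝ) (v : ℝ≥0) (l : ℝ) :
    ∫ z, exp (l * z) ∂gaussianReal ν v = exp (ν * l + v * l ^ 2 / 2) := by
  simpa [mgf] using congrFun (mgf_id_gaussianReal (μ := ν) (v := v)) l

lemma lintegral_exp_mul_gaussianReal (ν : ℝ) (v : ℝ≥0) (l : ℝ) :
    ∫⁻ z, ENNReal.ofReal (exp (l * z)) ∂gaussianReal ν v
      = ENNReal.ofReal (exp (ν * l + v * l ^ 2 / 2)) := by
  rw [← ofReal_integral_eq_lintegral_ofReal (integrable_exp_mul_gaussianReal l)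
    (ae_of_all _ fun _ => (exp_pos _).le), integral_exp_mul_gaussianReal]

lemma integrable_exp_mul_sub_gaussianReal (ν : ℝ) (v : ℝ≥0) (l γ : ℝ) :
    Integrable (fun z => exp (l * (z - γ))) (gaussianReal ν v) := by
  simp only [mul_sub, exp_sub, div_eq_mul_inv]
  exact (integrable_exp_mul_gaussianReal l).mul_const _

lemma integral_exp_tilt_gaussianReal (ν : ℝ) {σ : ℝ≥0} (hσ : 0 < σ) (x : ℝ) :
    ∫ z, exp (x / σ * (z - (ν + σ * x))) ∂gaussianReal ν (σ ^ 2) = exp (-x ^ 2 / 2) := by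
  simp only [mul_sub (x / σ), exp_sub]
  rw [integral_div, integral_exp_mul_gaussianReal, ← exp_sub]
  congr 1
  push_cast
  field_simp
  ring

lemma gaussianReal_real_Ici_le_exp (ν : ℝ) {v : ℝ≥0} (hv : v ≠ 0) {r : ℝ} (hr : 0 ≤ r) :
    (gaussianReal ν v).real (Ici (ν + r)) ≤ exp (-r ^ 2 / (2 * v)) := by
  have chernoff := measure_ge_le_exp_mul_mgf (μ := gaussianReal ν v) (X := id) (ν + r)
    (t := r / v) (by positivity) (integrable_exp_mul_gaussianReal _)
  rw [mgf_id_gaussianReal, ← exp_add] at chernoff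
  refine chernoff.trans (le_of_eq ?_)
  congr 1
  field_simp
  ring

lemma gaussianReal_real_apply (ν : ℝ) {v : ℝ≥0} (hv : v ≠ 0) (s : Set ℝ) :
    (gaussianReal ν v).real s = ∫ z in s, gaussianPDFReal ν v z := by
  rw [measureReal_def, gaussianReal_apply_eq_integral _ hv,
    ENNReal.toReal_ofReal (integral_nonneg fun z => gaussianPDFReal_nonneg _ _ z)]

-- Completing the square replaces the quadratic exponent by its tangent at `ν + b`.
lemma gaussianPDFReal_le_exp_mul (ν : ℝ) {v : ℝ≥0} (hv : v ≠ 0) (b z : ℝ) :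
    gaussianPDFReal ν v z
      ≤ (√v)⁻¹ * exp (b ^ 2 / (2 * v) + b / v * ν) * exp (-(b / v) * z) := by
  have hscale : (√(2 * π * v))⁻¹ ≤ (√v)⁻¹ := by
    have hv' : (0 : ℝ) < v := by positivity
    gcongr
    nlinarith [pi_gt_three]
  have htangent : -(z - ν) ^ 2 / (2 * v) ≤ b ^ 2 / (2 * v) + b / v * ν + -(b / v) * z := by
    have hsquare : b ^ 2 / (2 * v) + b / v * ν + -(b / v) * z - -(z - ν) ^ 2 / (2 * (v : ℝ))
        = (z - ν - b) ^ 2 / (2 * v) := by field_simp; ring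
    have : 0 ≤ (z - ν - b) ^ 2 / (2 * (v : ℝ)) := by positivity
    linarith
  rw [gaussianPDFReal, mul_assoc (√(v : ℝ))⁻¹, ← exp_add]
  gcongr

lemma gaussianReal_real_Ici_le_mills (ν : ℝ) {v : ℝ≥0} (hv : v ≠ 0) {b : ℝ} (hb : 0 < b) :
    (gaussianReal ν v).real (Ici (ν + b)) ≤ √v / b * exp (-b ^ 2 / (2 * v)) := by
  have hslope : -(b / (v : ℝ)) < 0 := neg_neg_of_pos (by positivity)
  have hexponent : b ^ 2 / (2 * v) + b / v * ν + -(b / v) * (ν + b) = -b ^ 2 / (2 * (v : ℝ)) := by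
    field_simp
    ring
  calc (gaussianReal ν v).real (Ici (ν + b))
      = ∫ z in Ioi (ν + b), gaussianPDFReal ν v z := by
        rw [gaussianReal_real_apply ν hv, integral_Ici_eq_integral_Ioi]
    _ ≤ ∫ z in Ioi (ν + b),
          (√v)⁻¹ * exp (b ^ 2 / (2 * v) + b / v * ν) * exp (-(b / v) * z) :=
        setIntegral_mono_on (integrable_gaussianPDFReal ν v).integrableOn
          ((integrableOn_exp_mul_Ioi hslope _).const_mul _) measurableSet_Ioi
          fun z _ => gaussianPDFReal_le_exp_mul ν hv b z
    _ = (√v)⁻¹ * (v / b) * exp (-b ^ 2 / (2 * v)) := by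
        rw [integral_const_mul, integral_exp_mul_Ioi hslope, ← hexponent, exp_add _ (_ * (ν + b)),
          neg_div_neg_eq, div_div_eq_mul_div]
        ring
    _ = √v / b * exp (-b ^ 2 / (2 * v)) := by
        rw [← mul_div_assoc, ← div_eq_inv_mul, div_sqrt]

lemma half_le_gaussianReal_Ici (ν : ℝ) (v : ℝ≥0) {b : ℝ} (hb : b ≤ ν) :
    1 / 2 ≤ gaussianReal ν v (Ici b) := by
  have hsymm : gaussianReal ν v (Iic ν) = gaussianReal ν v (Ici ν) := by
    have hreflect := gaussianReal_map_const_sub (μ := ν) (v := v) (2 * ν)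
    rw [show 2 * ν - ν = ν by ring] at hreflect
    conv_lhs => rw [← hreflect, Measure.map_apply (by fun_prop) measurableSet_Iic]
    congr 1 with z
    simp only [mem_preimage, mem_Iic, mem_Ici]
    constructor <;> intro <;> linarith
  have hcover : 1 ≤ gaussianReal ν v (Ici ν) * 2 := by
    calc (1 : ENNReal) = gaussianReal ν v (Iic ν ∪ Ici ν) := by rw [Iic_union_Ici, measure_univ]
      _ ≤ gaussianReal ν v (Ici ν) * 2 := (measure_union_le _ _).trans (by rw [hsymm, mul_two])
  exact (ENNReal.div_le_of_le_mul hcover).trans (measure_mono (Ici_subset_Ici.2 hb))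

lemma mul_gaussianPDFReal_le_gaussianReal_real_Icc (ν : ℝ) {v : ℝ≥0} (hv : v ≠ 0) {a b : ℝ}
    (ha : 0 ≤ a) (hab : a ≤ b) :
    (b - a) * gaussianPDFReal ν v (ν + b) ≤ (gaussianReal ν v).real (Icc (ν + a) (ν + b)) := by
  calc (b - a) * gaussianPDFReal ν v (ν + b)
      = ∫ _ in Icc (ν + a) (ν + b), gaussianPDFReal ν v (ν + b) := by
        rw [setIntegral_const, measureReal_def, volume_Icc,
          ENNReal.toReal_ofReal (by linarith), smul_eq_mul]
        ring
    _ ≤ ∫ z in Icc (ν + a) (ν + b), gaussianPDFReal ν v z := by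
        refine setIntegral_mono_on (integrableOn_const (by simp))
          (integrable_gaussianPDFReal ν v).integrableOn measurableSet_Icc fun z hz => ?_
        have hnonneg : 0 ≤ z - ν := by linarith [hz.1]
        have hle : z - ν ≤ ν + b - ν := by linarith [hz.2]
        rw [gaussianPDFReal, gaussianPDFReal]
        gcongr
    _ = (gaussianReal ν v).real (Icc (ν + a) (ν + b)) := (gaussianReal_real_apply ν hv _).symm

lemma inv_hundred_le_exp_neg_four : 1 / 100 ≤ exp (-4) := by
  rw [exp_neg, one_div]
  gcongr
  calc exp 4 = exp 1 ^ 4 := by rw [← exp_nat_mul]; norm_num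
    _ ≤ 2.7182818286 ^ 4 := by gcongr; exact exp_one_lt_d9.le
    _ ≤ 100 := by norm_num

lemma le_gaussianReal_real_Icc (ν : ℝ) {σ : ℝ≥0} (hσ : 0 < σ) {x : ℝ} (hx : 1 ≤ x) :
    exp (-x ^ 2 / 2) / x / 400
      ≤ (gaussianReal ν (σ ^ 2)).real (Icc (ν + σ * x + σ / x) (ν + σ * x + 2 * (σ / x))) := by
  have hx0 : 0 < x := by linarith
  have hscale : √(2 * π * (σ : ℝ) ^ 2) ≤ 3 * σ :=
    sqrt_le_iff.2 ⟨by positivity, by nlinarith [pi_lt_d2, sq_nonneg (σ : ℝ)]⟩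
  have hquad : (x + 2 / x) ^ 2 ≤ x ^ 2 + 8 := by
    have : 2 / x ≤ 2 := (div_le_iff₀ hx0).2 (by linarith)
    have : 0 < 2 / x := by positivity
    have : x * (2 / x) = 2 := by field_simp
    nlinarith
  have hexponent : -x ^ 2 / 2 + -4 ≤ -(σ * x + 2 * (σ / x)) ^ 2 / (2 * (σ : ℝ) ^ 2) := by
    have : (σ * x + 2 * (σ / x)) ^ 2 / (2 * (σ : ℝ) ^ 2) = (x + 2 / x) ^ 2 / 2 := by field_simp
    rw [neg_div _ ((σ * x + 2 * (σ / x)) ^ 2), this]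
    linarith
  calc exp (-x ^ 2 / 2) / x / 400
      ≤ σ / x * ((3 * (σ : ℝ))⁻¹ * (exp (-x ^ 2 / 2) * (1 / 100))) := by
        rw [show σ / x * ((3 * (σ : ℝ))⁻¹ * (exp (-x ^ 2 / 2) * (1 / 100)))
          = exp (-x ^ 2 / 2) / x / 300 by field_simp; norm_num]
        gcongr
        norm_num
    _ ≤ σ / x * ((3 * (σ : ℝ))⁻¹ * exp (-x ^ 2 / 2 + -4)) := by
        rw [exp_add]
        gcongr
        exact inv_hundred_le_exp_neg_four
    _ ≤ σ / x * ((√(2 * π * (σ : ℝ) ^ 2))⁻¹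
          * exp (-(σ * x + 2 * (σ / x)) ^ 2 / (2 * (σ : ℝ) ^ 2))) := by
        gcongr
    _ = (σ * x + 2 * (σ / x) - (σ * x + σ / x))
          * gaussianPDFReal ν (σ ^ 2) (ν + (σ * x + 2 * (σ / x))) := by
        rw [gaussianPDFReal, add_sub_cancel_left, NNReal.coe_pow]
        ring
    _ ≤ _ := by
        rw [add_assoc, add_assoc]
        refine mul_gaussianPDFReal_le_gaussianReal_real_Icc ν (by positivity) (by positivity) ?_
        gcongr
        linarith [show 0 ≤ σ / x by positivity]

lemma integrable_id_gaussianReal (ν : ℝ) (v : ℝ≥0) :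
    Integrable (fun z : ℝ => z) (gaussianReal ν v) :=
  (memLp_id_gaussianReal (μ := ν) (v := v) 1).integrable le_rfl

lemma integral_abs_sub_mean_gaussianReal_le (ν : ℝ) (v : ℝ≥0) :
    ∫ z, |z - ν| ∂gaussianReal ν v ≤ √v := by
  have hL2 : MemLp (fun z : ℝ => |z - ν|) 2 (gaussianReal ν v) :=
    ((memLp_id_gaussianReal 2).sub (memLp_const ν)).abs
  have hsecond : ∫ z, |z - ν| ^ 2 ∂gaussianReal ν v = v := by
    simp only [sq_abs]
    rw [← variance_fun_id_gaussianReal (μ := ν) (v := v), variance_eq_integral (by fun_prop),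
      integral_id_gaussianReal]
  have hvar := variance_nonneg (fun z : ℝ => |z - ν|) (gaussianReal ν v)
  rw [variance_eq_sub hL2] at hvar
  refine le_sqrt_of_sq_le ?_
  simp only [Pi.pow_apply, hsecond] at hvar
  linarith

lemma integral_abs_sub_gaussianReal_le (ν γ : ℝ) (v : ℝ≥0) :
    ∫ z, |z - γ| ∂gaussianReal ν v ≤ √v + |ν - γ| := by
  have hint (c : ℝ) : Integrable (fun z => |z - c|) (gaussianReal ν v) :=
    ((integrable_id_gaussianReal ν v).sub (integrable_const c)).abs
  calc ∫ z, |z - γ| ∂gaussianReal ν v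
      ≤ ∫ z, (|z - ν| + |ν - γ|) ∂gaussianReal ν v :=
        integral_mono (hint γ) ((hint ν).add (integrable_const _)) fun z => abs_sub_le z ν γ
    _ = ∫ z, |z - ν| ∂gaussianReal ν v + |ν - γ| := by
        rw [integral_add (hint ν) (integrable_const _)]
        simp
    _ ≤ √v + |ν - γ| := by
        gcongr
        exact integral_abs_sub_mean_gaussianReal_le ν v

lemma lintegral_gaussianReal_Ici_sub (v v' : ℝ≥0) (r : ℝ) :
    ∫⁻ z, gaussianReal 0 v (Ici (r - z)) ∂gaussianReal 0 v' = gaussianReal 0 (v' + v) (Ici r) := by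
  rw [← add_zero (0 : ℝ), ← gaussianReal_conv_gaussianReal, Measure.conv,
    Measure.map_apply (by fun_prop) measurableSet_Ici,
    Measure.prod_apply (measurableSet_Ici.preimage (by fun_prop))]
  simp only [add_zero]
  congr with z
  congr with y
  simp [add_comm z]

/-! ### The Gaussian random walk -/

/-- The law of the noise of the successive plays of an arm. -/
def noiseMeasure : Measure (ℕ → ℝ) := Measure.infinitePi fun _ : ℕ => gaussianReal 0 1

instance : IsProbabilityMeasure noiseMeasure := by unfold noiseMeasure; infer_instance

/-- The Gaussian random walk: the sum of the first `k` noise variables. -/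
def noiseSum (k : ℕ) (ω : ℕ → ℝ) : ℝ := ∑ s ∈ Finset.range k, ω s

@[fun_prop]
lemma measurable_noiseSum (k : ℕ) : Measurable (noiseSum k) := by
  unfold noiseSum; fun_prop

lemma noiseSum_zero (ω : ℕ → ℝ) : noiseSum 0 ω = 0 := Finset.sum_range_zero _

lemma noiseSum_succ (k : ℕ) (ω : ℕ → ℝ) : noiseSum (k + 1) ω = noiseSum k ω + ω k :=
  Finset.sum_range_succ _ k

lemma dependsOn_noiseSum {j k : ℕ} (hj : j ≤ k) : DependsOn (noiseSum j) (Finset.range k) :=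
  fun _ _ h => Finset.sum_congr rfl fun i hi => h i <| by
    simpa using (Finset.mem_range.1 hi).trans_le hj

lemma map_eval_noiseMeasure (k : ℕ) : noiseMeasure.map (fun ω => ω k) = gaussianReal 0 1 :=
  Measure.infinitePi_map_eval (fun _ : ℕ => gaussianReal 0 1) k

lemma iIndepFun_eval_noiseMeasure : iIndepFun (fun (i : ℕ) (ω : ℕ → ℝ) => ω i) noiseMeasure :=
  iIndepFun_infinitePi (X := fun _ => id) (P := fun _ => gaussianReal 0 1) fun _ => measurable_id

lemma map_noiseSum (k : ℕ) : noiseMeasure.map (noiseSum k) = gaussianReal 0 k := by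
  induction k with
  | zero =>
    rw [funext noiseSum_zero, Measure.map_const]
    simp
  | succ k ih =>
    have hindep : IndepFun (noiseSum k) (fun ω : ℕ → ℝ => ω k) noiseMeasure := by
      convert iIndepFun_eval_noiseMeasure.indepFun_finsetSum_of_notMem
        (fun i => measurable_pi_apply i) (s := Finset.range k) Finset.notMem_range_self using 1
      funext ω
      rw [noiseSum, Finset.sum_apply]
    have hsucc : noiseSum (k + 1) = noiseSum k + fun ω => ω k := funext (noiseSum_succ k)
    rw [hsucc, gaussianReal_add_gaussianReal_of_indepFun hindep ih (map_eval_noiseMeasure k),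
      add_zero, Nat.cast_succ]

lemma noiseMeasure_real_noiseSum_ge (k : ℕ) (r : ℝ) :
    noiseMeasure.real {ω | r ≤ noiseSum k ω} = (gaussianReal 0 k).real (Ici r) := by
  rw [← map_noiseSum k, map_measureReal_apply (measurable_noiseSum k) measurableSet_Ici]
  rfl

lemma noiseMeasure_real_noiseSum_ge_le_exp {k : ℕ} (hk : 0 < k) {r : ℝ} (hr : 0 ≤ r) :
    noiseMeasure.real {ω | r ≤ noiseSum k ω} ≤ exp (-r ^ 2 / (2 * k)) := by
  simpa [noiseMeasure_real_noiseSum_ge] using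
    gaussianReal_real_Ici_le_exp 0 (v := (k : ℝ≥0)) (by positivity) hr

lemma half_le_noiseMeasure_real_noiseSum_nonneg (k : ℕ) :
    1 / 2 ≤ noiseMeasure.real {ω | 0 ≤ noiseSum k ω} := by
  rw [noiseMeasure_real_noiseSum_ge]
  simpa [measureReal_def] using
    ENNReal.toReal_mono (by finiteness) (half_le_gaussianReal_Ici 0 (k : ℝ≥0) le_rfl)

lemma lintegral_infinitePi_eval {ι : Type*} {E : ι → Type*} [∀ i, MeasurableSpace (E i)]
    (ρ : ∀ i, Measure (E i)) [∀ i, IsProbabilityMeasure (ρ i)] {s : Finset ι} {k : ι} (hk : k ∉ s)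
    {F : (∀ i, E i) → E k → ENNReal} (hF : Measurable F.uncurry) (hdep : DependsOn F s) :
    ∫⁻ ω, F ω (ω k) ∂Measure.infinitePi ρ
      = ∫⁻ ω, ∫⁻ z, F ω z ∂ρ k ∂Measure.infinitePi ρ := by
  classical
  obtain ⟨ω₀⟩ := (Measure.infinitePi ρ).nonempty_of_neZero
  let complete : (∀ i : s, E i) → ∀ i, E i := Function.updateFinset ω₀ s
  have hcomplete (ω : ∀ i, E i) : F (complete (s.restrict ω)) = F ω :=
    hdep fun i hi => by simp [complete, Function.updateFinset, Finset.mem_coe.1 hi]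
  have hG : Measurable fun p : (∀ i : s, E i) × E k => F (complete p.1) p.2 :=
    hF.comp ((measurable_updateFinset.comp measurable_fst).prodMk measurable_snd)
  have hindep : IndepFun s.restrict (fun ω => ω k) (Measure.infinitePi ρ) :=
    ((iIndepFun_infinitePi (X := fun _ => id) (P := ρ) fun _ => measurable_id).indepFun_finset
      s {k} (by simpa using hk) fun i => measurable_pi_apply i).comp measurable_id
      (measurable_pi_apply (⟨k, Finset.mem_singleton_self k⟩ : ({k} : Finset ι)))
  have hlaw := (indepFun_iff_map_prod_eq_prod_map_map (by fun_prop)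
    (measurable_pi_apply k).aemeasurable).1 hindep
  rw [Measure.infinitePi_map_eval ρ k] at hlaw
  calc ∫⁻ ω, F ω (ω k) ∂Measure.infinitePi ρ
      = ∫⁻ p, F (complete p.1) p.2
          ∂(Measure.infinitePi ρ).map fun ω => (s.restrict ω, ω k) := by
        rw [lintegral_map hG (by fun_prop)]
        simp only [hcomplete]
    _ = ∫⁻ ω, ∫⁻ z, F ω z ∂ρ k ∂Measure.infinitePi ρ := by
        rw [hlaw, lintegral_prod _ hG.aemeasurable,
          lintegral_map hG.lintegral_prod_right' (by fun_prop)]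
        simp only [hcomplete]

/-! ### Potentials of the Gaussian random walk -/

/-- `V` is a potential for the cost `c`: at every time `T` and position `w` of the Gaussian random
walk, its value pays for the current cost and for its mean after the next step. -/
structure IsPotential (c V : ℕ → ℝ → ENNReal) : Prop where
  measurable_cost : ∀ T, Measurable (c T)
  measurable : ∀ T, Measurable (V T)
  cost_add_mean_le : ∀ T w, c T w + ∫⁻ z, V (T + 1) (w + z) ∂gaussianReal 0 1 ≤ V T w

/-- A superharmonic function of time and position: its values along the Gaussian random walk form a
supermartingale. -/
abbrev IsSuperharmonic (V : ℕ → ℝ → ENNReal) : Prop := IsPotential 0 V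

section Potential

variable {c c' V V' : ℕ → ℝ → ENNReal}

lemma IsPotential.measurable_shift (h : IsPotential c V) (T : ℕ) (w : ℝ) :
    Measurable fun z => V T (w + z) :=
  (h.measurable T).comp (measurable_const_add w)

lemma IsPotential.add (h : IsPotential c V) (h' : IsPotential c' V') :
    IsPotential (c + c') (V + V') where
  measurable_cost T := (h.measurable_cost T).add (h'.measurable_cost T)
  measurable T := (h.measurable T).add (h'.measurable T)
  cost_add_mean_le T w := by
    simp only [Pi.add_apply]
    rw [lintegral_add_left (h.measurable_shift (T + 1) w), add_add_add_comm]
    exact add_le_add (h.cost_add_mean_le T w) (h'.cost_add_mean_le T w)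

lemma IsSuperharmonic.of_mean_le (hV : ∀ T, Measurable (V T))
    (hmean : ∀ T w, ∫⁻ z, V (T + 1) (w + z) ∂gaussianReal 0 1 ≤ V T w) : IsSuperharmonic V :=
  ⟨fun _ => measurable_zero, hV, fun T w => by simpa using hmean T w⟩

lemma IsSuperharmonic.mean_le (h : IsSuperharmonic V) (T : ℕ) (w : ℝ) :
    ∫⁻ z, V (T + 1) (w + z) ∂gaussianReal 0 1 ≤ V T w := by
  simpa using h.cost_add_mean_le T w

lemma isSuperharmonic_const (a : ENNReal) : IsSuperharmonic fun _ _ => a :=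
  .of_mean_le (fun _ => measurable_const) fun _ _ => by simp

lemma IsSuperharmonic.const_mul (h : IsSuperharmonic V) (a : ENNReal) :
    IsSuperharmonic fun T w => a * V T w :=
  .of_mean_le (fun T => (h.measurable T).const_mul a) fun T w => by
    rw [lintegral_const_mul a (h.measurable_shift (T + 1) w)]
    gcongr
    exact h.mean_le T w

lemma IsSuperharmonic.sum {ι : Type*} {s : Finset ι} {V : ι → ℕ → ℝ → ENNReal}
    (h : ∀ i ∈ s, IsSuperharmonic (V i)) : IsSuperharmonic fun T w => ∑ i ∈ s, V i T w :=
  .of_mean_le (fun T => Finset.measurable_fun_sum _ fun i hi => (h i hi).measurable T)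
    fun T w => by
      rw [lintegral_finsetSum _ fun i hi => (h i hi).measurable_shift (T + 1) w]
      exact Finset.sum_le_sum fun i hi => (h i hi).mean_le T w

lemma lintegral_exp_walk (l κ w : ℝ) (T : ℕ) :
    ∫⁻ z, ENNReal.ofReal (exp (l * (w + z) - κ * ((T + 1 : ℕ) : ℝ))) ∂gaussianReal 0 1
      = ENNReal.ofReal (exp (l ^ 2 / 2 - κ)) * ENNReal.ofReal (exp (l * w - κ * T)) := by
  have hsplit (z : ℝ) : ENNReal.ofReal (exp (l * (w + z) - κ * ((T + 1 : ℕ) : ℝ)))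
      = ENNReal.ofReal (exp (l * w - κ * (T + 1))) * ENNReal.ofReal (exp (l * z)) := by
    rw [← ENNReal.ofReal_mul (exp_pos _).le, ← exp_add]
    congr 2
    push_cast
    ring
  simp_rw [hsplit]
  rw [lintegral_const_mul _ (by fun_prop), lintegral_exp_mul_gaussianReal,
    ← ENNReal.ofReal_mul (exp_pos _).le, ← ENNReal.ofReal_mul (exp_pos _).le, ← exp_add, ← exp_add]
  congr 2
  push_cast
  ring

lemma isSuperharmonic_exp (l : ℝ) :
    IsSuperharmonic fun T w => ENNReal.ofReal (exp (l * w - l ^ 2 / 2 * T)) :=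
  .of_mean_le (fun T => by fun_prop) fun T w =>
    (lintegral_exp_walk l (l ^ 2 / 2) w T).trans_le (by simp)

/-- The event that `V` has reached the level `1` along the walk by time `k`. -/
def crossedSet (V : ℕ → ℝ → ENNReal) (k : ℕ) : Set (ℕ → ℝ) :=
  {ω | ∃ j ≤ k, 1 ≤ V j (noiseSum j ω)}

lemma IsPotential.measurableSet_crossedSet (h : IsPotential c V) (k : ℕ) :
    MeasurableSet (crossedSet V k) := by
  simp only [crossedSet, ← exists_prop, ofPred_exists]
  exact .iUnion fun j => .iUnion fun _ =>
    measurableSet_le measurable_const ((h.measurable j).comp (measurable_noiseSum j))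

lemma mem_crossedSet_succ {k : ℕ} {ω : ℕ → ℝ} :
    ω ∈ crossedSet V (k + 1) ↔ ω ∈ crossedSet V k ∨ 1 ≤ V (k + 1) (noiseSum k ω + ω k) := by
  simp only [crossedSet, mem_ofPred_eq, Nat.le_succ_iff, or_and_right, exists_or,
    exists_eq_left, noiseSum_succ]

lemma dependsOn_mem_crossedSet (V : ℕ → ℝ → ENNReal) (k : ℕ) :
    DependsOn (· ∈ crossedSet V k) (Finset.range k) := fun _ _ h =>
  propext <| exists_congr fun j => and_congr_right fun hj => by rw [dependsOn_noiseSum hj h]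

open Classical in
/-- The supermartingale of `V`, replaced by `1` from the time when it reaches the level `1`. -/
def stoppedPotential (V : ℕ → ℝ → ENNReal) (k : ℕ) (ω : ℕ → ℝ) : ENNReal :=
  if ω ∈ crossedSet V k then 1 else V k (noiseSum k ω)

lemma IsSuperharmonic.lintegral_stoppedPotential_succ_le (hV : IsSuperharmonic V) (k : ℕ) :
    ∫⁻ ω, stoppedPotential V (k + 1) ω ∂noiseMeasure
      ≤ ∫⁻ ω, stoppedPotential V k ω ∂noiseMeasure := by
  classical
  let next (ω : ℕ → ℝ) (z : ℝ) : ENNReal :=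
    if ω ∈ crossedSet V k then 1 else V (k + 1) (noiseSum k ω + z)
  have hle (ω : ℕ → ℝ) : stoppedPotential V (k + 1) ω ≤ next ω (ω k) := by
    simp only [stoppedPotential, next, mem_crossedSet_succ, noiseSum_succ]
    split_ifs <;> simp_all
  have hnext : Measurable next.uncurry :=
    .ite ((hV.measurableSet_crossedSet k).preimage measurable_fst) measurable_const
      ((hV.measurable (k + 1)).comp (by fun_prop))
  have hdep : DependsOn next (Finset.range k) := fun ω ω' h => by
    have hmem := dependsOn_mem_crossedSet V k h
    simp only at hmem
    simp only [next, hmem, dependsOn_noiseSum le_rfl h]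
  calc ∫⁻ ω, stoppedPotential V (k + 1) ω ∂noiseMeasure
      ≤ ∫⁻ ω, next ω (ω k) ∂noiseMeasure := lintegral_mono hle
    _ = ∫⁻ ω, ∫⁻ z, next ω z ∂gaussianReal 0 1 ∂noiseMeasure :=
        lintegral_infinitePi_eval _ Finset.notMem_range_self hnext hdep
    _ ≤ ∫⁻ ω, stoppedPotential V k ω ∂noiseMeasure := by
        refine lintegral_mono fun ω => ?_
        by_cases h : ω ∈ crossedSet V k
        · simp [next, stoppedPotential, h]
        · simpa [next, stoppedPotential, h] using hV.mean_le k (noiseSum k ω)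

lemma stoppedPotential_zero_le (ω : ℕ → ℝ) : stoppedPotential V 0 ω ≤ V 0 0 := by
  by_cases h : 1 ≤ V 0 0 <;> simp [stoppedPotential, crossedSet, noiseSum_zero, h]

/-- Ville's inequality for superharmonic functions of the Gaussian random walk. -/
theorem IsSuperharmonic.noiseMeasure_crossedSet_le (hV : IsSuperharmonic V) (k : ℕ) :
    noiseMeasure (crossedSet V k) ≤ V 0 0 := by
  have hstart : ∫⁻ ω, stoppedPotential V 0 ω ∂noiseMeasure ≤ V 0 0 :=
    (lintegral_mono stoppedPotential_zero_le).trans_eq (by simp)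
  calc noiseMeasure (crossedSet V k)
      = ∫⁻ ω, (crossedSet V k).indicator 1 ω ∂noiseMeasure :=
        (lintegral_indicator_one (hV.measurableSet_crossedSet k)).symm
    _ ≤ ∫⁻ ω, stoppedPotential V k ω ∂noiseMeasure := lintegral_mono fun ω => by
        by_cases h : ω ∈ crossedSet V k <;> simp [stoppedPotential, h]
    _ ≤ ∫⁻ ω, stoppedPotential V 0 ω ∂noiseMeasure :=
        antitone_nat_of_succ_le (f := fun k => ∫⁻ ω, stoppedPotential V k ω ∂noiseMeasure)
          hV.lintegral_stoppedPotential_succ_le (Nat.zero_le k)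
    _ ≤ V 0 0 := hstart

end Potential

lemma noiseMeasure_exists_noiseSum_le_line (a u : ℝ) (hu : 0 ≤ u) (k : ℕ) :
    noiseMeasure {ω | ∃ j ≤ k, noiseSum j ω ≤ -a - u / 2 * j}
      ≤ ENNReal.ofReal (exp (-(a * u))) := by
  have hsuper := (isSuperharmonic_exp (-u)).const_mul (ENNReal.ofReal (exp (-(a * u))))
  calc noiseMeasure {ω | ∃ j ≤ k, noiseSum j ω ≤ -a - u / 2 * j}
      ≤ _ := measure_mono ?_
    _ ≤ _ := hsuper.noiseMeasure_crossedSet_le k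
    _ = ENNReal.ofReal (exp (-(a * u))) := by simp
  rintro ω ⟨j, hj, h⟩
  refine ⟨j, hj, ?_⟩
  beta_reduce
  rw [← ENNReal.ofReal_mul (exp_pos _).le, ← exp_add, ENNReal.one_le_ofReal, one_le_exp_iff]
  nlinarith [mul_le_mul_of_nonneg_left h hu]

/-- The probability that the walk, now at time `T` and position `w`, is at least `b` at time `k`. -/
def tailPotential (k : ℕ) (b : ℝ) (T : ℕ) (w : ℝ) : ENNReal :=
  if T ≤ k then gaussianReal 0 ((k - T : ℕ) : ℝ≥0) (Ici (b - w)) else 0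

lemma isSuperharmonic_tailPotential (k : ℕ) (b : ℝ) : IsSuperharmonic (tailPotential k b) := by
  refine .of_mean_le (fun T => ?_) fun T w => ?_
  · unfold tailPotential
    split_ifs
    · exact Monotone.measurable fun w w' h => measure_mono (Ici_subset_Ici.2 (by linarith))
    · exact measurable_const
  · unfold tailPotential
    by_cases h : T + 1 ≤ k
    · have hvar : ((k - T : ℕ) : ℝ≥0) = 1 + ((k - (T + 1) : ℕ) : ℝ≥0) := by
        norm_cast
        omega
      simp only [h, (by omega : T ≤ k), if_true, hvar, ← lintegral_gaussianReal_Ici_sub,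
        sub_add_eq_sub_sub, le_refl]
    · simp [h]

lemma half_le_tailPotential {k T : ℕ} (hT : T ≤ k) {b w : ℝ} (hb : b ≤ w) :
    1 / 2 ≤ tailPotential k b T w := by
  rw [tailPotential, if_pos hT]
  exact half_le_gaussianReal_Ici _ _ (sub_nonpos.2 hb)

lemma tailPotential_zero_le {k : ℕ} (hk : 1 ≤ k) {b : ℝ} (hb : 0 < b) :
    tailPotential k b 0 0 ≤ ENNReal.ofReal (√k / b * exp (-b ^ 2 / (2 * k))) := by
  rw [tailPotential, if_pos (Nat.zero_le k), ← ofReal_measureReal]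
  gcongr
  simpa using gaussianReal_real_Ici_le_mills 0 (v := (k : ℝ≥0)) (by positivity) hb

/-! ### Elementary properties of the Gittins index -/

lemma armMeasure_eq (ν : ℝ) (v : ℝ≥0) : armMeasure ν v = (gaussianReal ν v).prod noiseMeasure := rfl

instance (ν : ℝ) (v : ℝ≥0) : IsProbabilityMeasure (armMeasure ν v) := by
  rw [armMeasure_eq]
  infer_instance

lemma integral_armMeasure_fst (ν : ℝ) (v : ℝ≥0) (f : ℝ → ℝ) :
    ∫ ω, f ω.1 ∂armMeasure ν v = ∫ z, f z ∂gaussianReal ν v := by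
  rw [armMeasure_eq, integral_fun_fst, probReal_univ, one_smul]

lemma integrable_armMeasure_fst {ν : ℝ} {v : ℝ≥0} {f : ℝ → ℝ}
    (hf : Integrable f (gaussianReal ν v)) :
    Integrable (fun ω : ArmSpace => f ω.1) (armMeasure ν v) := by
  rw [armMeasure_eq]
  exact hf.comp_fst _

lemma integrable_sub_const_gaussianReal (ν γ : ℝ) (v : ℝ≥0) :
    Integrable (fun z => z - γ) (gaussianReal ν v) :=
  (integrable_id_gaussianReal ν v).sub (integrable_const γ)

lemma integral_sub_const_gaussianReal (ν γ : ℝ) (v : ℝ≥0) :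
    ∫ z, (z - γ) ∂gaussianReal ν v = ν - γ := by
  rw [integral_sub (integrable_id_gaussianReal ν v) (integrable_const γ), integral_id_gaussianReal]
  simp

lemma isArmStoppingTime_one {m : ℕ} (hm : 1 ≤ m) : IsArmStoppingTime m fun _ => 1 :=
  ⟨isStoppingTime_const _ 1, fun _ => ⟨le_rfl, hm⟩⟩

namespace IsArmStoppingTime

variable {m : ℕ} {τ : ArmSpace → ℕ}

lemma one_le (h : IsArmStoppingTime m τ) (ω : ArmSpace) : (1 : ℝ) ≤ τ ω :=
  mod_cast (h.2 ω).1

lemma le (h : IsArmStoppingTime m τ) (ω : ArmSpace) : (τ ω : ℝ) ≤ m :=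
  mod_cast (h.2 ω).2

protected lemma measurable (h : IsArmStoppingTime m τ) : Measurable τ :=
  measurable_of_Iic fun i => by
    simpa [preimage, Iic] using armFiltration.le i _ (h.1 i)

lemma integrable (h : IsArmStoppingTime m τ) (ν : ℝ) (v : ℝ≥0) (γ : ℝ) :
    Integrable (fun ω : ArmSpace => (ω.1 - γ) * (τ ω : ℝ)) (armMeasure ν v) :=
  (integrable_armMeasure_fst (integrable_sub_const_gaussianReal ν γ v)).mul_bdd (c := m)
    (measurable_from_nat.comp h.measurable).aestronglyMeasurable
    (ae_of_all _ fun ω => by simpa using h.le ω)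

lemma mul_le_add_exp (h : IsArmStoppingTime m τ) {l : ℝ} (hl : 0 < l) (γ : ℝ) (ω : ArmSpace) :
    (ω.1 - γ) * τ ω ≤ (ω.1 - γ) + m * (exp (l * (ω.1 - γ)) / l) := by
  have hpos : max (ω.1 - γ) 0 ≤ exp (l * (ω.1 - γ)) / l := by
    rw [le_div_iff₀ hl, max_mul_of_nonneg _ _ hl.le, zero_mul]
    exact max_le (by linarith [add_one_le_exp (l * (ω.1 - γ))]) (exp_pos _).le
  have hextra : (ω.1 - γ) * (τ ω - 1) ≤ m * (exp (l * (ω.1 - γ)) / l) :=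
    calc (ω.1 - γ) * (τ ω - 1)
        ≤ max (ω.1 - γ) 0 * (τ ω - 1) :=
          mul_le_mul_of_nonneg_right (le_max_left _ _) (by linarith [h.one_le ω])
      _ ≤ max (ω.1 - γ) 0 * m :=
          mul_le_mul_of_nonneg_left (by linarith [h.le ω]) (le_max_right _ _)
      _ ≤ m * (exp (l * (ω.1 - γ)) / l) := by
          rw [mul_comm]
          gcongr
  linarith

lemma integral_le (h : IsArmStoppingTime m τ) (ν : ℝ) {σ : ℝ≥0} (hσ : 0 < σ) {x : ℝ}
    (hx : 0 < x) :
    ∫ ω, (ω.1 - (ν + σ * x)) * (τ ω : ℝ) ∂armMeasure ν (σ ^ 2)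
      ≤ σ * (-x + m * exp (-x ^ 2 / 2) / x) := by
  have : (0 : ℝ) < σ := hσ
  have hmean := integrable_sub_const_gaussianReal ν (ν + σ * x) (σ ^ 2)
  have hexp := ((integrable_exp_mul_sub_gaussianReal ν (σ ^ 2) (x / σ) (ν + σ * x)).div_const
    (x / σ)).const_mul (m : ℝ)
  let bound (z : ℝ) : ℝ :=
    (z - (ν + σ * x)) + m * (exp (x / σ * (z - (ν + σ * x))) / (x / σ))
  calc ∫ ω, (ω.1 - (ν + σ * x)) * (τ ω : ℝ) ∂armMeasure ν (σ ^ 2)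
      ≤ ∫ ω, bound ω.1 ∂armMeasure ν (σ ^ 2) :=
        integral_mono (h.integrable ν _ _) (integrable_armMeasure_fst (hmean.add hexp))
          (h.mul_le_add_exp (by positivity) _)
    _ = σ * (-x + m * exp (-x ^ 2 / 2) / x) := by
        rw [integral_armMeasure_fst ν _ bound, integral_add hmean hexp,
          integral_sub_const_gaussianReal, integral_const_mul, integral_div,
          integral_exp_tilt_gaussianReal ν hσ]
        field_simp
        ring

end IsArmStoppingTime

section StoppingValue

variable {ν γ : ℝ} {m : ℕ}

lemma bddAbove_stoppingValue_set (ν : ℝ) (v : ℝ≥0) (m : ℕ) (γ : ℝ) :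
    BddAbove {x : ℝ | ∃ τ : ArmSpace → ℕ, IsArmStoppingTime m τ ∧
      x = ∫ ω, (ω.1 - γ) * (τ ω : ℝ) ∂(armMeasure ν v)} := by
  refine ⟨∫ ω : ArmSpace, |ω.1 - γ| * m ∂armMeasure ν v, ?_⟩
  rintro _ ⟨τ, hτ, rfl⟩
  refine integral_mono (hτ.integrable ν v γ)
    ((integrable_armMeasure_fst (integrable_sub_const_gaussianReal ν γ v)).abs.mul_const _)
    fun ω => ?_
  exact mul_le_mul (le_abs_self _) (hτ.le ω) (by positivity) (abs_nonneg _)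

lemma stoppingValue_mean_nonneg (ν : ℝ) (v : ℝ≥0) (hm : 1 ≤ m) : 0 ≤ stoppingValue ν v m ν := by
  refine le_csSup (bddAbove_stoppingValue_set ν v m ν) ⟨_, isArmStoppingTime_one hm, ?_⟩
  simp [integral_armMeasure_fst ν v (fun z => z - ν), integral_sub_const_gaussianReal]

lemma stoppingValue_le (hm : 1 ≤ m) {σ : ℝ≥0} (hσ : 0 < σ) {x : ℝ} (hx : 0 < x) :
    stoppingValue ν (σ ^ 2) m (ν + σ * x) ≤ σ * (-x + m * exp (-x ^ 2 / 2) / x) := by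
  refine csSup_le ⟨_, _, isArmStoppingTime_one hm, rfl⟩ ?_
  rintro _ ⟨τ, hτ, rfl⟩
  exact hτ.integral_le ν hσ hx

lemma le_of_stoppingValue_nonneg (hm : 1 ≤ m) {σ : ℝ≥0} (hσ : 0 < σ) {x : ℝ} (hx : 1 ≤ x)
    (hmx : (m : ℝ) ≤ exp (x ^ 2 / 2)) (h : 0 ≤ stoppingValue ν (σ ^ 2) m γ) :
    γ ≤ ν + σ * x := by
  have hσ' : (0 : ℝ) < σ := hσ
  by_contra! hlt
  obtain ⟨y, rfl⟩ : ∃ y, γ = ν + σ * y := ⟨(γ - ν) / σ, by field_simp; ring⟩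
  have hxy : x < y := lt_of_mul_lt_mul_left (by linarith) hσ'.le
  have htail : m * exp (-y ^ 2 / 2) < 1 :=
    calc m * exp (-y ^ 2 / 2)
        ≤ exp (x ^ 2 / 2) * exp (-y ^ 2 / 2) := by gcongr
      _ < 1 := by
        rw [← exp_add, exp_lt_one_iff]
        nlinarith
  have hdiv : m * exp (-y ^ 2 / 2) / y < y := by
    rw [div_lt_iff₀ (by linarith)]
    nlinarith
  have hneg : σ * (-y + m * exp (-y ^ 2 / 2) / y) < 0 :=
    mul_neg_of_pos_of_neg hσ' (by linarith)
  linarith [stoppingValue_le (ν := ν) hm hσ (by linarith : 0 < y)]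

lemma gittinsIndex_le (hm : 1 ≤ m) {σ : ℝ≥0} (hσ : 0 < σ) {x : ℝ} (hx : 1 ≤ x)
    (hmx : (m : ℝ) ≤ exp (x ^ 2 / 2)) : gittinsIndex ν (σ ^ 2) m ≤ ν + σ * x :=
  csSup_le ⟨ν, stoppingValue_mean_nonneg ν _ hm⟩ fun _ h =>
    le_of_stoppingValue_nonneg hm hσ hx hmx h

lemma le_gittinsIndex_of_stoppingValue_nonneg {σ : ℝ≥0} (hσ : 0 < σ) (hm : 1 ≤ m)
    (h : 0 ≤ stoppingValue ν (σ ^ 2) m γ) : γ ≤ gittinsIndex ν (σ ^ 2) m := by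
  refine le_csSup ⟨ν + σ * (m + 1), fun γ' h' => ?_⟩ h
  refine le_of_stoppingValue_nonneg hm hσ (by simp) ?_ h'
  nlinarith [add_one_le_exp (((m : ℝ) + 1) ^ 2 / 2)]

lemma le_gittinsIndex_of_isArmStoppingTime {σ : ℝ≥0} (hσ : 0 < σ) {τ : ArmSpace → ℕ}
    (hm : 1 ≤ m) (hτ : IsArmStoppingTime m τ)
    (h : 0 ≤ ∫ ω, (ω.1 - γ) * (τ ω : ℝ) ∂(armMeasure ν (σ ^ 2))) :
    γ ≤ gittinsIndex ν (σ ^ 2) m :=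
  le_gittinsIndex_of_stoppingValue_nonneg hσ hm
    (h.trans (le_csSup (bddAbove_stoppingValue_set ν _ m γ) ⟨τ, hτ, rfl⟩))

lemma le_gittinsIndex (ν : ℝ) {σ : ℝ≥0} (hσ : 0 < σ) (hm : 1 ≤ m) :
    ν ≤ gittinsIndex ν (σ ^ 2) m :=
  le_gittinsIndex_of_stoppingValue_nonneg hσ hm (stoppingValue_mean_nonneg ν _ hm)

end StoppingValue

/-! ### A stopping rule for a Gaussian arm -/

/-- The sum of the first `k` observations, each reduced by `γ`. -/
def armSum (γ : ℝ) (k : ℕ) (ω : ArmSpace) : ℝ := ∑ s ∈ Finset.range k, (armObs s ω - γ)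

lemma armSum_eq (γ : ℝ) (k : ℕ) (ω : ArmSpace) :
    armSum γ k ω = k * (ω.1 - γ) + noiseSum k ω.2 := by
  simp only [armSum, armObs, noiseSum, Finset.sum_sub_distrib, Finset.sum_add_distrib,
    Finset.sum_const, Finset.card_range, nsmul_eq_mul]
  ring

lemma measurable_armObs_armFiltration {s k : ℕ} (hs : s < k) :
    Measurable[armFiltration k] (armObs s) :=
  (comap_measurable (armObs s)).mono (le_iSup₂_of_le s hs le_rfl) le_rfl

lemma measurable_armSum_armFiltration (γ : ℝ) (k : ℕ) :
    Measurable[armFiltration k] (armSum γ k) :=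
  Finset.measurable_fun_sum _ fun _ hs =>
    (measurable_armObs_armFiltration (Finset.mem_range.1 hs)).sub_const γ

/-- The test statistic of the stopping rule, which rejects the arm when it is nonpositive. The
observations have to stay above a falling line before the time `k`, and above `0` at the time `k`;
afterwards the arm is never rejected. -/
def ruleProcess (γ u : ℝ) (k j : ℕ) (ω : ArmSpace) : ℝ :=
  if j < k then armSum γ j ω + 2 / u + u / 2 * j else if j = k then armSum γ j ω else 1

/-- The stopping rule that tests whether the mean exceeds `γ`, with `m` rounds to go. -/
def ruleTime (γ u : ℝ) (k m : ℕ) (ω : ArmSpace) : ℕ :=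
  hittingBtwn (ruleProcess γ u k) (Iic 0) 1 m ω

lemma isArmStoppingTime_ruleTime (γ u : ℝ) (k : ℕ) {m : ℕ} (hm : 1 ≤ m) :
    IsArmStoppingTime m (ruleTime γ u k m) := by
  refine ⟨Adapted.isStoppingTime_hittingBtwn (fun j => ?_) measurableSet_Iic,
    fun ω => ⟨le_hittingBtwn hm ω, hittingBtwn_le ω⟩⟩
  have hsum := measurable_armSum_armFiltration γ j
  unfold ruleProcess
  split_ifs
  · exact (hsum.add_const _).add_const _
  · exact hsum
  · exact measurable_const

/-- The noise paths on which the rule never rejects a mean above `γ`. -/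
def survivalSet (u : ℝ) (k : ℕ) : Set (ℕ → ℝ) :=
  {ω | 0 ≤ noiseSum k ω} \ {ω | ∃ j ≤ k, noiseSum j ω ≤ -(2 / u) - u / 2 * j}

lemma measurableSet_survivalSet (u : ℝ) (k : ℕ) : MeasurableSet (survivalSet u k) := by
  refine (measurableSet_le measurable_const (measurable_noiseSum k)).diff ?_
  simp only [← exists_prop, ofPred_exists]
  exact .iUnion fun j => .iUnion fun _ => measurableSet_le (measurable_noiseSum j) measurable_const

lemma third_le_survivalSet {u : ℝ} (hu : 0 < u) (k : ℕ) :
    1 / 3 ≤ noiseMeasure.real (survivalSet u k) := by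
  have hline : noiseMeasure.real {ω | ∃ j ≤ k, noiseSum j ω ≤ -(2 / u) - u / 2 * j}
      ≤ exp (-2) := by
    have h := noiseMeasure_exists_noiseSum_le_line (2 / u) u hu.le k
    rw [div_mul_cancel₀ _ hu.ne'] at h
    exact ENNReal.toReal_le_of_le_ofReal (exp_pos _).le h
  have hexp : exp (-2) ≤ 1 / 6 := by
    rw [exp_neg, one_div, show (2 : ℝ) = 1 + 1 by norm_num, exp_add]
    exact inv_anti₀ (by norm_num) (by nlinarith [exp_one_gt_d9])
  calc 1 / 3
      ≤ noiseMeasure.real {ω | 0 ≤ noiseSum k ω}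
        - noiseMeasure.real {ω | ∃ j ≤ k, noiseSum j ω ≤ -(2 / u) - u / 2 * j} := by
        linarith [half_le_noiseMeasure_real_noiseSum_nonneg k]
    _ ≤ noiseMeasure.real (survivalSet u k) := le_measureReal_sdiff

/-- A bound for the number of plays that the rule needs to reject a mean below `γ - 3 u / 4`. -/
def rejectionCount (u : ℝ) (k : ℕ) (ω : ℕ → ℝ) : ℝ :=
  1 + ∑ j ∈ Finset.Ico 1 k, {ω : ℕ → ℝ | u / 4 * j - 2 / u ≤ noiseSum j ω}.indicator 1 ω

lemma rejectionCount_nonneg (u : ℝ) (k : ℕ) (ω : ℕ → ℝ) : 0 ≤ rejectionCount u k ω :=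
  add_nonneg zero_le_one (Finset.sum_nonneg fun _ _ => indicator_nonneg (by simp) _)

section RuleTime

variable {γ u : ℝ} {k m : ℕ} {ω : ArmSpace}

lemma ruleTime_eq_of_mem_survivalSet (hk : 1 ≤ k) (hθ : γ < ω.1) (hω : ω.2 ∈ survivalSet u k) :
    ruleTime γ u k m ω = m := by
  refine hittingBtwn_eq_end_iff.2 fun ⟨j, ⟨hj₁, _⟩, hj⟩ => ?_
  exfalso
  have hdrift : 0 < j * (ω.1 - γ) := mul_pos (by exact_mod_cast hj₁) (sub_pos.2 hθ)
  simp only [ruleProcess, armSum_eq, mem_Iic] at hj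
  split_ifs at hj with hlt heq
  · exact hω.2 ⟨j, hlt.le, by linarith⟩
  · subst heq
    linarith [show 0 ≤ noiseSum j ω.2 from hω.1]
  · linarith

lemma ruleTime_le (hm : k ≤ m) (hk : 1 ≤ k) (hsum : armSum γ k ω ≤ 0) : ruleTime γ u k m ω ≤ k :=
  hittingBtwn_le_of_mem hk hm (by simpa [ruleProcess] using hsum)

lemma ruleTime_le_rejectionCount (hm : k ≤ m) (hk : 1 ≤ k) (hθ : ω.1 - γ ≤ -(3 * u / 4))
    (hsum : armSum γ k ω ≤ 0) : (ruleTime γ u k m ω : ℝ) ≤ rejectionCount u k ω.2 := by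
  let event (j : ℕ) : Set (ℕ → ℝ) := {ω | u / 4 * j - 2 / u ≤ noiseSum j ω}
  have hle : ruleTime γ u k m ω ≤ k := ruleTime_le hm hk hsum
  have hone : 1 ≤ ruleTime γ u k m ω := le_hittingBtwn (hk.trans hm) ω
  have hevent : ∀ j ∈ Finset.Ico 1 (ruleTime γ u k m ω), ω.2 ∈ event j := fun j hj => by
    obtain ⟨hj₁, hj₂⟩ := Finset.mem_Ico.1 hj
    have hnot : ruleProcess γ u k j ω ∉ Iic 0 := notMem_of_lt_hittingBtwn hj₂ hj₁
    simp only [ruleProcess, hj₂.trans_le hle, if_true, armSum_eq, mem_Iic, not_le] at hnot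
    simp only [event, mem_ofPred_eq]
    nlinarith [mul_le_mul_of_nonneg_left hθ (Nat.cast_nonneg (α := ℝ) j)]
  calc (ruleTime γ u k m ω : ℝ)
      = 1 + ∑ j ∈ Finset.Ico 1 (ruleTime γ u k m ω), (event j).indicator 1 ω.2 := by
        rw [Finset.sum_congr rfl fun j hj => indicator_of_mem (hevent j hj) _]
        simp [Nat.cast_sub hone]
    _ ≤ rejectionCount u k ω.2 := by
        unfold rejectionCount
        gcongr
        exact fun _ _ _ => indicator_nonneg (by simp) _

/-- The event that the rule accepts the arm after `k` plays, for a mean below `γ`. -/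
def acceptanceSet (γ : ℝ) (k : ℕ) : Set ArmSpace := {ω | k * max (γ - ω.1) 0 ≤ noiseSum k ω.2}

/-- A bound for the loss of the rule: of rejecting means well below `γ`, of testing means slightly
below `γ`, and of accepting means below `γ`. -/
def ruleLoss (γ u : ℝ) (k m : ℕ) (ω : ArmSpace) : ℝ :=
  |ω.1 - γ| * rejectionCount u k ω.2 + u * k * (Ici (γ - 3 * u / 4)).indicator 1 ω.1
    + m * (max (γ - ω.1) 0 * (acceptanceSet γ k).indicator 1 ω)

lemma ruleLoss_summands_nonneg (hu : 0 < u) (ω : ArmSpace) :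
    0 ≤ |ω.1 - γ| * rejectionCount u k ω.2 ∧
    0 ≤ u * k * (Ici (γ - 3 * u / 4)).indicator (1 : ℝ → ℝ) ω.1 ∧
    0 ≤ m * (max (γ - ω.1) 0 * (acceptanceSet γ k).indicator (1 : ArmSpace → ℝ) ω) :=
  ⟨mul_nonneg (abs_nonneg _) (rejectionCount_nonneg u k _),
    mul_nonneg (by positivity) (indicator_nonneg (by simp) _),
    mul_nonneg (by positivity) (mul_nonneg (le_max_right _ _) (indicator_nonneg (by simp) _))⟩

lemma ruleLoss_nonneg (hu : 0 < u) (ω : ArmSpace) : 0 ≤ ruleLoss γ u k m ω := by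
  obtain ⟨h₁, h₂, h₃⟩ := ruleLoss_summands_nonneg (γ := γ) (k := k) (m := m) hu ω
  exact add_nonneg (add_nonneg h₁ h₂) h₃

lemma mul_ruleTime_le_ruleLoss (hu : 0 < u) (hm : k ≤ m) (hk : 1 ≤ k) (hθ : ω.1 < γ) :
    (γ - ω.1) * ruleTime γ u k m ω ≤ ruleLoss γ u k m ω := by
  have hθ' : 0 < γ - ω.1 := sub_pos.2 hθ
  have hmax : max (γ - ω.1) 0 = γ - ω.1 := max_eq_left hθ'.le
  obtain ⟨hrejection, htest, haccept⟩ := ruleLoss_summands_nonneg (γ := γ) (k := k) (m := m) hu ω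
  unfold ruleLoss
  rcases le_or_gt (armSum γ k ω) 0 with hsum | hsum
  · by_cases hfar : ω.1 - γ ≤ -(3 * u / 4)
    · have := mul_le_mul_of_nonneg_left (ruleTime_le_rejectionCount hm hk hfar hsum) hθ'.le
      rw [abs_sub_comm, abs_of_pos hθ'] at hrejection ⊢
      linarith
    · have hmem : ω.1 ∈ Ici (γ - 3 * u / 4) := by
        rw [mem_Ici]
        linarith
      have : (γ - ω.1) * ruleTime γ u k m ω ≤ u * k :=
        mul_le_mul (by linarith) (mod_cast ruleTime_le hm hk hsum) (by positivity) hu.le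
      rw [indicator_of_mem hmem, Pi.one_apply, mul_one] at htest ⊢
      linarith
  · have hmem : ω ∈ acceptanceSet γ k := by
      rw [armSum_eq] at hsum
      rw [acceptanceSet, mem_ofPred_eq, hmax]
      linarith
    have := mul_le_mul_of_nonneg_left
      ((isArmStoppingTime_ruleTime γ u k (hk.trans hm)).le ω) hθ'.le
    rw [indicator_of_mem hmem, hmax, Pi.one_apply, mul_one]
    linarith

lemma gain_sub_ruleLoss_le {q : ℝ} (hu : 0 < u) (hq : 0 < q) (hm : k ≤ m) (hk : 1 ≤ k)
    (ω : ArmSpace) :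
    m * q * ((Icc (γ + q) (γ + 2 * q)).indicator 1 ω.1 * (survivalSet u k).indicator 1 ω.2)
      - ruleLoss γ u k m ω ≤ (ω.1 - γ) * (ruleTime γ u k m ω : ℝ) := by
  rcases le_or_gt γ ω.1 with hθ | hθ
  · have hreward : 0 ≤ (ω.1 - γ) * (ruleTime γ u k m ω : ℝ) :=
      mul_nonneg (sub_nonneg.2 hθ) (Nat.cast_nonneg _)
    have hloss := ruleLoss_nonneg (γ := γ) (k := k) (m := m) hu ω
    by_cases hmean : ω.1 ∈ Icc (γ + q) (γ + 2 * q)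
    · by_cases hnoise : ω.2 ∈ survivalSet u k
      · rw [ruleTime_eq_of_mem_survivalSet hk (by linarith [hmean.1]) hnoise,
          indicator_of_mem hmean, indicator_of_mem hnoise, Pi.one_apply, Pi.one_apply, mul_one,
          mul_one, mul_comm (m : ℝ)]
        have : q * m ≤ (ω.1 - γ) * m := by
          gcongr
          linarith [hmean.1]
        linarith
      · rw [indicator_of_notMem hnoise]
        linarith
    · rw [indicator_of_notMem hmean]
      linarith
  · rw [indicator_of_notMem fun h => by linarith [h.1]]
    linarith [mul_ruleTime_le_ruleLoss hu hm hk hθ]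

end RuleTime

/-! ### The value of the stopping rule -/

lemma sum_exp_neg_mul_le {c : ℝ} (hc : 0 < c) (n : ℕ) :
    ∑ k ∈ Finset.Ico 1 n, exp (-(c * k)) ≤ 1 / c := by
  have hlt : exp (-c) < 1 := exp_lt_one_iff.2 (by linarith)
  calc ∑ k ∈ Finset.Ico 1 n, exp (-(c * k))
      = ∑ k ∈ Finset.Ico 1 n, exp (-c) ^ k :=
        Finset.sum_congr rfl fun k _ => by rw [← exp_nat_mul, mul_neg, mul_comm]
    _ ≤ exp (-c) ^ 1 / (1 - exp (-c)) := geom_sum_Ico_le_of_lt_one (exp_pos _).le hlt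
    _ ≤ 1 / c := by
        rw [pow_one, div_le_div_iff₀ (by linarith) hc]
        have : exp (-c) * (1 + c) ≤ 1 := by
          rw [exp_neg, inv_mul_le_one₀ (exp_pos _)]
          linarith [add_one_le_exp c]
        linarith

lemma noiseMeasure_real_rejection_le {u : ℝ} (hu : 0 < u) {j : ℕ} (hj : 1 ≤ j) :
    noiseMeasure.real {ω | u / 4 * j - 2 / u ≤ noiseSum j ω} ≤ 2 * exp (-(u ^ 2 / 32 * j)) := by
  have hexp : exp (1 / 2) ≤ 2 := by
    have : exp (1 / 2) ^ 2 = exp 1 := by rw [← exp_nat_mul]; norm_num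
    nlinarith [exp_one_lt_d9, exp_pos (1 / 2)]
  have : (0 : ℝ) < j := by exact_mod_cast hj
  calc noiseMeasure.real {ω | u / 4 * j - 2 / u ≤ noiseSum j ω}
      ≤ exp (1 / 2 - u ^ 2 / 32 * j) := by
        rcases le_total 0 (u / 4 * j - 2 / u) with hr | hr
        · refine (noiseMeasure_real_noiseSum_ge_le_exp hj hr).trans (exp_le_exp.2 ?_)
          rw [div_le_iff₀ (by positivity)]
          have hcross : u * j * (2 / u) = 2 * j := by field_simp
          nlinarith [sq_nonneg (2 / u)]
        · refine measureReal_le_one.trans (one_le_exp ?_)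
          have hscale : u ^ 2 / 32 * j - 1 / 4 = u / 8 * (u / 4 * j - 2 / u) := by
            field_simp
            ring
          linarith [mul_nonpos_of_nonneg_of_nonpos (by positivity : 0 ≤ u / 8) hr]
    _ = exp (1 / 2) * exp (-(u ^ 2 / 32 * j)) := by rw [← exp_add, sub_eq_add_neg]
    _ ≤ 2 * exp (-(u ^ 2 / 32 * j)) := by gcongr

lemma measurableSet_le_noiseSum (r : ℝ) (k : ℕ) : MeasurableSet {ω | r ≤ noiseSum k ω} :=
  measurableSet_le measurable_const (measurable_noiseSum k)

lemma integrable_rejectionCount (u : ℝ) (k : ℕ) :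
    Integrable (rejectionCount u k) noiseMeasure :=
  (integrable_const _).add <| integrable_finsetSum _ fun j _ =>
    (integrable_const (1 : ℝ)).indicator (measurableSet_le_noiseSum _ j)

lemma integral_rejectionCount_le {u : ℝ} (hu : 0 < u) (k : ℕ) :
    ∫ ω, rejectionCount u k ω ∂noiseMeasure ≤ 1 + 64 / u ^ 2 := by
  have hint (j : ℕ) : Integrable
      ({ω : ℕ → ℝ | u / 4 * j - 2 / u ≤ noiseSum j ω}.indicator (1 : (ℕ → ℝ) → ℝ)) noiseMeasure :=
    (integrable_const (1 : ℝ)).indicator (measurableSet_le_noiseSum _ j)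
  calc ∫ ω, rejectionCount u k ω ∂noiseMeasure
      = 1 + ∑ j ∈ Finset.Ico 1 k, noiseMeasure.real {ω | u / 4 * j - 2 / u ≤ noiseSum j ω} := by
        unfold rejectionCount
        rw [integral_add (integrable_const _) (integrable_finsetSum _ fun j _ => hint j),
          integral_finsetSum _ fun j _ => hint j]
        simp only [integral_indicator_one (measurableSet_le_noiseSum _ _), integral_const,
          probReal_univ, smul_eq_mul, mul_one]
    _ ≤ 1 + ∑ j ∈ Finset.Ico 1 k, 2 * exp (-(u ^ 2 / 32 * j)) := by
        gcongr with j hj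
        exact noiseMeasure_real_rejection_le hu (Finset.mem_Ico.1 hj).1
    _ ≤ 1 + 2 * (1 / (u ^ 2 / 32)) := by
        rw [← Finset.mul_sum]
        gcongr
        exact sum_exp_neg_mul_le (by positivity) k
    _ = 1 + 64 / u ^ 2 := by
        field_simp
        norm_num

lemma mul_exp_neg_sq_le {κ s y : ℝ} (hκ : 0 < κ) (hs : s ≤ κ) (hy : 0 ≤ y) :
    y * exp (-(κ ^ 2 * y ^ 2) / 2) ≤ 8 / κ * exp (-(s * y)) := by
  have hexp : exp 2 ≤ 8 := by
    rw [show (2 : ℝ) = 1 + 1 by norm_num, exp_add]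
    nlinarith [exp_one_lt_d9, exp_pos 1]
  rw [div_mul_eq_mul_div, le_div_iff₀ hκ]
  calc y * exp (-(κ ^ 2 * y ^ 2) / 2) * κ
      = κ * y * exp (-(κ ^ 2 * y ^ 2) / 2) := by ring
    _ ≤ exp (κ * y) * exp (-(κ ^ 2 * y ^ 2) / 2) := by
        refine mul_le_mul_of_nonneg_right ?_ (exp_pos _).le
        linarith [add_one_le_exp (κ * y)]
    _ ≤ exp 2 * exp (-(s * y)) := by
        rw [← exp_add, ← exp_add, exp_le_exp]
        nlinarith [sq_nonneg (κ * y - 2), mul_le_mul_of_nonneg_right hs hy]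
    _ ≤ 8 * exp (-(s * y)) := by gcongr

lemma measurableSet_acceptanceSet (γ : ℝ) (k : ℕ) : MeasurableSet (acceptanceSet γ k) :=
  measurableSet_le (by fun_prop) (by fun_prop)

lemma integrable_acceptance_loss (ν γ : ℝ) (v : ℝ≥0) (k : ℕ) :
    Integrable (fun ω : ArmSpace => max (γ - ω.1) 0 * (acceptanceSet γ k).indicator 1 ω)
      (armMeasure ν v) := by
  refine (integrable_armMeasure_fst (f := fun z => max (γ - z) 0) ?_).mul_bdd (c := 1)
    (measurable_one.indicator (measurableSet_acceptanceSet γ k)).aestronglyMeasurable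
    (ae_of_all _ fun ω => ?_)
  · exact ((integrable_const γ).sub (integrable_id_gaussianReal ν v)).pos_part
  · exact (norm_indicator_le_norm_self _ _).trans (by simp)

lemma max_mul_acceptance_probability_le {γ κ s : ℝ} {k : ℕ} (hk : 1 ≤ k) (hκ : 0 < κ)
    (hκk : κ ^ 2 ≤ k) (hs : s ≤ κ) (z : ℝ) :
    max (γ - z) 0 * noiseMeasure.real {w | k * max (γ - z) 0 ≤ noiseSum k w}
      ≤ 8 / κ * exp (s * (z - γ)) := by
  have : (0 : ℝ) < k := by exact_mod_cast hk
  rcases le_total (γ - z) 0 with hz | hz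
  · rw [max_eq_right hz, zero_mul]
    positivity
  rw [max_eq_left hz]
  calc (γ - z) * noiseMeasure.real {w | k * (γ - z) ≤ noiseSum k w}
      ≤ (γ - z) * exp (-(k * (γ - z)) ^ 2 / (2 * k)) := by
        gcongr
        exact noiseMeasure_real_noiseSum_ge_le_exp hk (by positivity)
    _ = (γ - z) * exp (-(k * (γ - z) ^ 2) / 2) := by
        congr 2
        field_simp
    _ ≤ (γ - z) * exp (-(κ ^ 2 * (γ - z) ^ 2) / 2) := by gcongr
    _ ≤ 8 / κ * exp (-(s * (γ - z))) := mul_exp_neg_sq_le hκ hs hz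
    _ = 8 / κ * exp (s * (z - γ)) := by
        congr 2
        ring

lemma integral_acceptance_loss_le (ν : ℝ) {σ : ℝ≥0} {x κ : ℝ} (hσ : 0 < σ) {k : ℕ} (hk : 1 ≤ k)
    (hκ : 0 < κ) (hκk : κ ^ 2 ≤ k) (hs : x / σ ≤ κ) :
    ∫ ω, max ((ν + σ * x) - ω.1) 0 * (acceptanceSet (ν + σ * x) k).indicator 1 ω
      ∂armMeasure ν (σ ^ 2) ≤ 8 / κ * exp (-x ^ 2 / 2) := by
  set γ := ν + σ * x with hγ
  have hint := integrable_acceptance_loss ν γ (σ ^ 2) k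
  rw [armMeasure_eq] at hint ⊢
  calc ∫ ω, max (γ - ω.1) 0 * (acceptanceSet γ k).indicator 1 ω
        ∂(gaussianReal ν (σ ^ 2)).prod noiseMeasure
      = ∫ z, ∫ w, max (γ - z) 0 * (acceptanceSet γ k).indicator 1 (z, w)
          ∂noiseMeasure ∂gaussianReal ν (σ ^ 2) := integral_prod _ hint
    _ ≤ ∫ z, 8 / κ * exp (x / σ * (z - γ)) ∂gaussianReal ν (σ ^ 2) := by
        refine integral_mono hint.integral_prod_left
          ((integrable_exp_mul_sub_gaussianReal ν _ (x / σ) γ).const_mul _) fun z => ?_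
        have hslice (w : ℕ → ℝ) : (acceptanceSet γ k).indicator (1 : ArmSpace → ℝ) (z, w)
            = {w : ℕ → ℝ | k * max (γ - z) 0 ≤ noiseSum k w}.indicator 1 w := rfl
        simp only [hslice]
        rw [integral_const_mul, integral_indicator_one (measurableSet_le_noiseSum _ k)]
        exact max_mul_acceptance_probability_le hk hκ hκk hs z
    _ = 8 / κ * exp (-x ^ 2 / 2) := by
        rw [integral_const_mul, hγ, integral_exp_tilt_gaussianReal ν hσ]

lemma integrable_abs_mul_rejectionCount (ν γ u : ℝ) (v : ℝ≥0) (k : ℕ) :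
    Integrable (fun ω : ArmSpace => |ω.1 - γ| * rejectionCount u k ω.2) (armMeasure ν v) := by
  rw [armMeasure_eq]
  exact (integrable_sub_const_gaussianReal ν γ v).abs.mul_prod (integrable_rejectionCount u k)

lemma integrable_indicator_Ici_fst (ν r : ℝ) (v : ℝ≥0) :
    Integrable (fun ω : ArmSpace => (Ici r).indicator (1 : ℝ → ℝ) ω.1) (armMeasure ν v) :=
  integrable_armMeasure_fst ((integrable_const (1 : ℝ)).indicator measurableSet_Ici)

lemma integrable_ruleLoss (ν γ u : ℝ) (v : ℝ≥0) (k m : ℕ) :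
    Integrable (ruleLoss γ u k m) (armMeasure ν v) :=
  ((integrable_abs_mul_rejectionCount ν γ u v k).add
    ((integrable_indicator_Ici_fst ν (γ - 3 * u / 4) v).const_mul (u * k))).add
    ((integrable_acceptance_loss ν γ v k).const_mul m)

lemma integral_ruleLoss_eq (ν γ u : ℝ) (v : ℝ≥0) (k m : ℕ) :
    ∫ ω, ruleLoss γ u k m ω ∂armMeasure ν v
      = (∫ z, |z - γ| ∂gaussianReal ν v) * ∫ w, rejectionCount u k w ∂noiseMeasure
        + u * k * (gaussianReal ν v).real (Ici (γ - 3 * u / 4))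
        + m * ∫ ω, max (γ - ω.1) 0 * (acceptanceSet γ k).indicator 1 ω ∂armMeasure ν v := by
  have hreject := integrable_abs_mul_rejectionCount ν γ u v k
  have htest := (integrable_indicator_Ici_fst ν (γ - 3 * u / 4) v).const_mul (u * k)
  have haccept := (integrable_acceptance_loss ν γ v k).const_mul (m : ℝ)
  unfold ruleLoss
  have hearly : Integrable (fun ω : ArmSpace => |ω.1 - γ| * rejectionCount u k ω.2
      + u * k * (Ici (γ - 3 * u / 4)).indicator 1 ω.1) (armMeasure ν v) := hreject.add htest
  rw [integral_add hearly haccept, integral_add hreject htest, integral_const_mul,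
    integral_const_mul, integral_armMeasure_fst ν v, integral_indicator_one measurableSet_Ici,
    armMeasure_eq, integral_prod_mul (fun z : ℝ => |z - γ|)]

lemma integral_ruleLoss_le (ν : ℝ) {σ : ℝ≥0} {x κ : ℝ} (hσ : 0 < σ) (hx : 1 ≤ x) {k : ℕ}
    (hk : 1 ≤ k) (m : ℕ) (hκ : 0 < κ) (hκk : κ ^ 2 ≤ k) (hs : x / σ ≤ κ) :
    ∫ ω, ruleLoss (ν + σ * x) (σ * x) k m ω ∂armMeasure ν (σ ^ 2)
      ≤ 2 * (σ * x) * (1 + 64 / (σ * x) ^ 2) + σ * x * k * exp (-x ^ 2 / 32)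
        + m * (8 / κ * exp (-x ^ 2 / 2)) := by
  have hσ' : (0 : ℝ) < σ := hσ
  have hu : 0 < σ * x := mul_pos hσ' (by linarith)
  have habs : ∫ z, |z - (ν + σ * x)| ∂gaussianReal ν (σ ^ 2) ≤ 2 * (σ * x) := by
    refine (integral_abs_sub_gaussianReal_le ν _ _).trans ?_
    rw [sub_add_cancel_left, abs_neg, abs_of_pos hu, NNReal.coe_pow, sqrt_sq hσ'.le]
    nlinarith
  have htail : (gaussianReal ν (σ ^ 2)).real (Ici (ν + σ * x - 3 * (σ * x) / 4))
      ≤ exp (-x ^ 2 / 32) := by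
    rw [show ν + σ * x - 3 * (σ * x) / 4 = ν + σ * x / 4 by ring]
    refine (gaussianReal_real_Ici_le_exp ν (pow_pos hσ 2).ne' (by positivity)).trans_eq ?_
    rw [NNReal.coe_pow]
    congr 1
    field_simp
    norm_num
  rw [integral_ruleLoss_eq]
  gcongr
  · exact integral_nonneg (rejectionCount_nonneg _ k)
  · exact integral_rejectionCount_le hu k
  · exact integral_acceptance_loss_le ν hσ hk hκ hκk hs

lemma integrable_gain (ν a b u : ℝ) (v : ℝ≥0) (k : ℕ) :
    Integrable (fun ω : ArmSpace => (Icc a b).indicator (1 : ℝ → ℝ) ω.1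
      * (survivalSet u k).indicator 1 ω.2) (armMeasure ν v) := by
  rw [armMeasure_eq]
  exact ((integrable_const (1 : ℝ)).indicator measurableSet_Icc).mul_prod
    ((integrable_const (1 : ℝ)).indicator (measurableSet_survivalSet u k))

lemma le_integral_gain (ν : ℝ) {σ : ℝ≥0} {u x : ℝ} (hσ : 0 < σ) (hx : 1 ≤ x) (hu : 0 < u)
    (k : ℕ) :
    exp (-x ^ 2 / 2) / x / 400 * (1 / 3)
      ≤ ∫ ω, (Icc (ν + σ * x + σ / x) (ν + σ * x + 2 * (σ / x))).indicator (1 : ℝ → ℝ) ω.1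
        * (survivalSet u k).indicator 1 ω.2 ∂armMeasure ν (σ ^ 2) := by
  rw [armMeasure_eq, integral_prod_mul, integral_indicator_one measurableSet_Icc,
    integral_indicator_one (measurableSet_survivalSet u k)]
  gcongr
  · exact le_gaussianReal_real_Icc ν hσ hx
  · exact third_le_survivalSet hu k

lemma le_integral_reward_ruleTime (ν : ℝ) {σ : ℝ≥0} {x κ : ℝ} (hσ : 0 < σ) (hx : 1 ≤ x)
    {k m : ℕ} (hk : 1 ≤ k) (hm : k ≤ m) (hκ : 0 < κ) (hκk : κ ^ 2 ≤ k) (hs : x / σ ≤ κ) :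
    m * (σ / x) * (exp (-x ^ 2 / 2) / x / 400 * (1 / 3))
      - (2 * (σ * x) * (1 + 64 / (σ * x) ^ 2) + σ * x * k * exp (-x ^ 2 / 32)
        + m * (8 / κ * exp (-x ^ 2 / 2)))
      ≤ ∫ ω, (ω.1 - (ν + σ * x)) * (ruleTime (ν + σ * x) (σ * x) k m ω : ℝ)
        ∂armMeasure ν (σ ^ 2) := by
  have hσ' : (0 : ℝ) < σ := hσ
  have hq : 0 < σ / x := div_pos hσ' (by linarith)
  have hu : 0 < σ * x := mul_pos hσ' (by linarith)
  have hgain := (integrable_gain ν (ν + σ * x + σ / x) (ν + σ * x + 2 * (σ / x)) (σ * x) (σ ^ 2)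
    k).const_mul (m * (σ / x))
  have hloss := integrable_ruleLoss ν (ν + σ * x) (σ * x) (σ ^ 2) k m
  refine le_trans ?_ (integral_mono (hgain.sub hloss)
    ((isArmStoppingTime_ruleTime _ (σ * x) k (hk.trans hm)).integrable ν _ _)
    (gain_sub_ruleLoss_le hu hq hm hk))
  rw [integral_sub' hgain hloss, integral_const_mul]
  gcongr
  · exact le_integral_gain ν hσ hx hu k
  · exact integral_ruleLoss_le ν hσ hx hk m hκ hκk hs

lemma pow_six_le_exp (x : ℝ) : x ^ 6 ≤ 196608 * exp (x ^ 2 / 32) := by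
  have hcubic : (x ^ 2 / 32) ^ 3 / (Nat.factorial 3 : ℕ) ≤ exp (x ^ 2 / 32) :=
    pow_div_factorial_le_exp _ (by positivity) 3
  norm_num [Nat.factorial] at hcubic
  linarith

/-- The constant in the number of rounds for which the index exceeds the posterior mean by `x`
posterior standard deviations. It is taken so large that a test of length `⌈κ ^ 2⌉` pays off, where
`κ = 19200 * x ^ 2 * s` (with `1 / s` the posterior standard deviation) is chosen to make the loss
after a wrong acceptance half of the gain. -/
def lowerIndexConst : ℝ := 2400 * (128 + 2 * 19200 ^ 2 * 196608)

lemma one_le_lowerIndexConst : 1 ≤ lowerIndexConst := by norm_num [lowerIndexConst]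

lemma ceil_test_length_le {s x : ℝ} (hs : 1 ≤ s) (hx : 1 ≤ x) :
    (⌈(19200 * x ^ 2 * s) ^ 2⌉₊ : ℝ) ≤ 2 * (19200 ^ 2 * x ^ 4 * s ^ 2) := by
  have hceil : (⌈(19200 * x ^ 2 * s) ^ 2⌉₊ : ℝ) < (19200 * x ^ 2 * s) ^ 2 + 1 :=
    Nat.ceil_lt_add_one (by positivity)
  have hone : 1 ≤ x ^ 4 * s ^ 2 := one_le_mul_of_one_le_of_one_le (one_le_pow₀ hx) (one_le_pow₀ hs)
  linarith

lemma test_length_le_horizon {s x : ℝ} (hx : 1 ≤ x) :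
    2 * (19200 ^ 2 * x ^ 4 * s ^ 2)
      ≤ lowerIndexConst * (exp (x ^ 2 / 2) * (x * (s ^ 2 + x ^ 2))) := by
  have hcube : x ^ 3 ≤ 8 * exp (x ^ 2 / 2) := by
    have hquad := quadratic_le_exp_of_nonneg (x := x ^ 2 / 2) (by positivity)
    have hpow : x ^ 3 ≤ x ^ 4 := pow_le_pow_right₀ hx (by norm_num)
    nlinarith
  have : 0 < x := by linarith
  calc 2 * (19200 ^ 2 * x ^ 4 * s ^ 2) = 2 * 19200 ^ 2 * (x * s ^ 2) * x ^ 3 := by ring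
    _ ≤ 2 * 19200 ^ 2 * (x * s ^ 2) * (8 * exp (x ^ 2 / 2)) := by gcongr
    _ = 16 * 19200 ^ 2 * (exp (x ^ 2 / 2) * (x * s ^ 2)) := by ring
    _ ≤ lowerIndexConst * (exp (x ^ 2 / 2) * (x * (s ^ 2 + x ^ 2))) := by
        gcongr
        · exact zero_le_one.trans one_le_lowerIndexConst
        · norm_num [lowerIndexConst]
        · exact le_add_of_nonneg_right (sq_nonneg x)

lemma test_cost_le {s x k : ℝ} (hs : 0 < s) (hx : 0 < x)
    (hk : k ≤ 2 * (19200 ^ 2 * x ^ 4 * s ^ 2)) :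
    x / s * k * exp (-x ^ 2 / 32) ≤ 2 * 19200 ^ 2 * 196608 * (s / x) := by
  calc x / s * k * exp (-x ^ 2 / 32)
      ≤ x / s * (2 * (19200 ^ 2 * x ^ 4 * s ^ 2)) * exp (-x ^ 2 / 32) := by gcongr
    _ = 2 * 19200 ^ 2 * (s / x) * (x ^ 6 * exp (-x ^ 2 / 32)) := by
        field_simp
    _ ≤ 2 * 19200 ^ 2 * (s / x) * 196608 := by
        gcongr
        rw [neg_div, exp_neg, mul_inv_le_iff₀ (exp_pos _)]
        exact pow_six_le_exp x
    _ = 2 * 19200 ^ 2 * 196608 * (s / x) := by ring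

lemma lowerIndexConst_mul_le {s x m : ℝ} (hs : 0 < s) (hx : 0 < x)
    (hm : lowerIndexConst * (exp (x ^ 2 / 2) * (x * (s ^ 2 + x ^ 2))) ≤ m) :
    lowerIndexConst * (s / x + x / s) ≤ m * (exp (-x ^ 2 / 2) / (s * x ^ 2)) :=
  calc lowerIndexConst * (s / x + x / s)
      = lowerIndexConst * (exp (x ^ 2 / 2) * (x * (s ^ 2 + x ^ 2)))
        * (exp (-x ^ 2 / 2) / (s * x ^ 2)) := by
        rw [neg_div, exp_neg]
        field_simp
    _ ≤ m * (exp (-x ^ 2 / 2) / (s * x ^ 2)) := by gcongr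

lemma ruleTime_loss_le_gain {s x m k : ℝ} (hs : 0 < s) (hx : 0 < x)
    (hk : k ≤ 2 * (19200 ^ 2 * x ^ 4 * s ^ 2))
    (hm : lowerIndexConst * (exp (x ^ 2 / 2) * (x * (s ^ 2 + x ^ 2))) ≤ m) :
    2 * (x / s) * (1 + 64 / (x / s) ^ 2) + x / s * k * exp (-x ^ 2 / 32)
        + m * (8 / (19200 * x ^ 2 * s) * exp (-x ^ 2 / 2))
      ≤ m * (1 / (s * x)) * (exp (-x ^ 2 / 2) / x / 400 * (1 / 3)) := by
  have hgain : m * (1 / (s * x)) * (exp (-x ^ 2 / 2) / x / 400 * (1 / 3))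
      = m * (exp (-x ^ 2 / 2) / (s * x ^ 2)) / 1200 := by
    field_simp
    ring
  have hacceptance : m * (8 / (19200 * x ^ 2 * s) * exp (-x ^ 2 / 2))
      = m * (exp (-x ^ 2 / 2) / (s * x ^ 2)) / 2400 := by
    field_simp
    ring
  have hrejection : 2 * (x / s) * (1 + 64 / (x / s) ^ 2) = 2 * (x / s) + 128 * (s / x) := by
    field_simp
    ring
  have hhorizon := lowerIndexConst_mul_le hs hx hm
  have htest := test_cost_le hs hx hk
  have : 0 < x / s := by positivity
  rw [hgain, hacceptance, hrejection]
  unfold lowerIndexConst at hhorizon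
  linarith

theorem add_div_le_gittinsIndex (ν : ℝ) {s : ℝ≥0} {x : ℝ} {m : ℕ} (hs : 1 ≤ s) (hx : 1 ≤ x)
    (hm : lowerIndexConst * (exp (x ^ 2 / 2) * (x * (s ^ 2 + x ^ 2))) ≤ m) :
    ν + x / s ≤ gittinsIndex ν (s⁻¹ ^ 2) m := by
  have hs' : (1 : ℝ) ≤ s := by exact_mod_cast hs
  have hx0 : 0 < x := by linarith
  have hσ : 0 < s⁻¹ := inv_pos.2 (by positivity)
  set κ : ℝ := 19200 * x ^ 2 * s with hκ
  set k := ⌈κ ^ 2⌉₊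
  have hk : 1 ≤ k := Nat.one_le_ceil_iff.2 (by positivity)
  have hk_le : (k : ℝ) ≤ 2 * (19200 ^ 2 * x ^ 4 * s ^ 2) := ceil_test_length_le hs' hx
  have hkm : k ≤ m := by exact_mod_cast hk_le.trans ((test_length_le_horizon hx).trans hm)
  have hslope : x / (s⁻¹ : ℝ≥0) ≤ κ := by
    rw [NNReal.coe_inv, div_inv_eq_mul, hκ]
    gcongr
    nlinarith
  have hvalue := le_integral_reward_ruleTime ν hσ hx hk hkm (by positivity) (Nat.le_ceil _) hslope
  have hpos := ruleTime_loss_le_gain (by linarith) hx0 hk_le hm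
  rw [div_eq_inv_mul, ← NNReal.coe_inv]
  refine le_gittinsIndex_of_isArmStoppingTime hσ (hk.trans hkm)
    (isArmStoppingTime_ruleTime _ _ k (hk.trans hkm)) (le_trans ?_ hvalue)
  have hscale : ((s⁻¹ : ℝ≥0) : ℝ) * x = x / s ∧ ((s⁻¹ : ℝ≥0) : ℝ) / x = 1 / (s * x) := by
    rw [NNReal.coe_inv]
    constructor <;> field_simp
  rw [hscale.1, hscale.2]
  exact sub_nonneg.2 hpos

/-! ### The index boundary -/

/-- Half the square of the boundary: an arm with `T` plays and of the order of `T * exp L` rounds to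
go has an index that exceeds its mean by at least `√(2 * halfSq L T / T)`. -/
def halfSq (L T : ℝ) : ℝ := L - log L / 2 - log (1 + L / T)

lemma log_le_div_eight_add {z : ℝ} (hz : 0 < z) : log z ≤ z / 8 + 5 / 4 := by
  have htangent := log_le_sub_one_of_pos (by positivity : 0 < z / 8)
  have hlog_eight : log 8 = 3 * log 2 := by
    rw [show (8 : ℝ) = 2 ^ 3 by norm_num, log_pow, Nat.cast_ofNat]
  rw [log_div hz.ne' (by norm_num)] at htangent
  linarith [log_two_lt_d9]

lemma le_halfSq {L T : ℝ} (hL : 20 ≤ L) (hT : 1 ≤ T) : L / 2 + 3 ≤ halfSq L T := by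
  have hratio : L / T ≤ L := div_le_self (by linarith) hT
  have hlog : log (1 + L / T) ≤ log (1 + L) := log_le_log (by positivity) (by linarith)
  unfold halfSq
  linarith [log_le_div_eight_add (by linarith : 0 < L),
    log_le_div_eight_add (by linarith : 0 < 1 + L)]

lemma halfSq_le {L T : ℝ} (hL : 1 ≤ L) (hT : 0 < T) : halfSq L T ≤ L := by
  have : 0 ≤ L / T := by positivity
  unfold halfSq
  linarith [log_nonneg hL, log_nonneg (by linarith : 1 ≤ 1 + L / T)]

lemma exp_halfSq {L T : ℝ} (hL : 0 < L) (hT : 0 < T) :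
    exp (halfSq L T) = exp L * T / (√L * (T + L)) := by
  unfold halfSq
  rw [exp_sub, exp_sub, exp_log (by positivity), exp_half, exp_log hL]
  field_simp

lemma exp_halfSq_mul_le {L T : ℝ} (hL : 20 ≤ L) (hT : 1 ≤ T) :
    exp (√(2 * halfSq L T) ^ 2 / 2) * (√(2 * halfSq L T) * (T + √(2 * halfSq L T) ^ 2))
      ≤ 3 * (exp L * T) := by
  have hge := le_halfSq hL hT
  have hle := halfSq_le (by linarith : 1 ≤ L) (by linarith : 0 < T)
  have hsqrt : √(2 * halfSq L T) ≤ 3 / 2 * √L := by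
    refine sqrt_le_iff.2 ⟨by positivity, ?_⟩
    rw [mul_pow, sq_sqrt (by linarith)]
    linarith
  rw [sq_sqrt (by linarith), mul_div_cancel_left₀ _ (by norm_num : (2 : ℝ) ≠ 0),
    exp_halfSq (by linarith) (by linarith)]
  calc exp L * T / (√L * (T + L)) * (√(2 * halfSq L T) * (T + 2 * halfSq L T))
      ≤ exp L * T / (√L * (T + L)) * (3 / 2 * √L * (2 * (T + L))) := by
        gcongr <;> linarith
    _ = 3 * (exp L * T) := by
        field_simp

lemma halfSq_sub_two_le {L L' T k : ℝ} (hL' : 1 ≤ L') (hT : 1 ≤ T) (hle : L' ≤ L)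
    (hle_add : L ≤ L' + 1) (hTk : T ≤ k) (hk : k ≤ 2 * T) : halfSq L' k - 2 ≤ halfSq L T := by
  have hk0 : 0 < k := by linarith
  have hlog : log L ≤ log 2 + log L' := by
    rw [← log_mul (by norm_num) (by linarith)]
    exact log_le_log (by linarith) (by linarith)
  have : 0 < L' / k := div_pos (by linarith) hk0
  have hlog_ratio : log (1 + L / T) ≤ 2 * log 2 + log (1 + L' / k) := by
    have hfour : 2 * log 2 + log (1 + L' / k) = log (4 * (1 + L' / k)) := by
      rw [log_mul (by norm_num) (by positivity), show (4 : ℝ) = 2 ^ 2 by norm_num, log_pow,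
        Nat.cast_ofNat]
    have hratio_le : L / T ≤ 4 * (L' / k) := by
      rw [← mul_div_assoc, div_le_div_iff₀ (by linarith) hk0]
      nlinarith [mul_le_mul hk (by linarith : L ≤ 2 * L') (by linarith) (by linarith)]
    rw [hfour]
    exact log_le_log (add_pos one_pos (div_pos (by linarith) (by linarith))) (by linarith)
  unfold halfSq
  linarith [log_two_lt_d9]

lemma boundary_block_le {L L' T k ε : ℝ} (hL' : 20 ≤ L') (hT : 1 ≤ T) (hle : L' ≤ L)
    (hle_add : L ≤ L' + 1) (hTk : T ≤ k) (hk : k ≤ T + T / L) (hε : 0 ≤ ε) :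
    ε * k / 2 + √(2 * (halfSq L' k - 3)) * √k ≤ ε * T + √(2 * halfSq L T) * √T := by
  have hL : 0 < L := by linarith
  have hTL : T / L ≤ T := div_le_self (by linarith) (by linarith)
  have hdrop := halfSq_sub_two_le (by linarith) hT hle hle_add hTk (by linarith)
  have hlower := le_halfSq hL' (hT.trans hTk)
  have hupper := halfSq_le (by linarith : 1 ≤ L') (by linarith : 0 < k)
  have hscaled : (halfSq L' k - 3) * k ≤ halfSq L T * T := by
    calc (halfSq L' k - 3) * k
        ≤ (halfSq L' k - 3) * (T + T / L) := by
          gcongr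
          linarith
      _ = (halfSq L' k - 3) * T + (halfSq L' k - 3) * (T / L) := by ring
      _ ≤ (halfSq L' k - 3) * T + L * (T / L) := by
          gcongr
          linarith
      _ = (halfSq L' k - 2) * T := by
          field_simp
          ring
      _ ≤ halfSq L T * T := by gcongr
  have hsqrt : √(2 * (halfSq L' k - 3)) * √k ≤ √(2 * halfSq L T) * √T := by
    rw [← sqrt_mul (by linarith), ← sqrt_mul (by linarith)]
    exact sqrt_le_sqrt (by linarith)
  nlinarith

section Block

variable {T : ℕ} {L : ℝ} {f : ℕ → ℝ}

lemma cast_le_add_div_of_mem_block (hL : 0 ≤ L) {k : ℕ}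
    (hk : k ∈ Finset.Icc T (T + ⌊T / L⌋₊)) : (k : ℝ) ≤ T + T / L := by
  have hcast : (k : ℝ) ≤ T + (⌊T / L⌋₊ : ℕ) := by exact_mod_cast (Finset.mem_Icc.1 hk).2
  linarith [Nat.floor_le (by positivity : 0 ≤ T / L)]

lemma div_le_block_term (hL : 21 ≤ L) (hTL : L ≤ T) {k : ℕ} {r : ℝ} (hr : 20 ≤ r) (hrL : r ≤ L)
    (hLr : L ≤ r + 1) (hk : k ∈ Finset.Icc T (T + ⌊T / L⌋₊)) :
    L / T ≤ 16 * r / (k + r) / 2 := by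
  have hk_le := cast_le_add_div_of_mem_block (by linarith) hk
  have hblock : T / L ≤ T := div_le_self (by linarith) (by linarith)
  rw [div_div, div_le_div_iff₀ (by linarith) (by positivity)]
  have : (k : ℝ) + r ≤ 3 * T := by linarith
  nlinarith

lemma one_le_block_sum (hL : 21 ≤ L)
    (hf : ∀ k ∈ Finset.Icc T (T + ⌊T / L⌋₊), 20 ≤ f k ∧ f k ≤ L ∧ L ≤ f k + 1) :
    1 ≤ ∑ k ∈ Finset.Icc T (T + ⌊T / L⌋₊), 16 * f k / (k + f k) / 2 := by
  have : (0 : ℝ) ≤ T := T.cast_nonneg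
  rcases lt_or_ge (T : ℝ) L with hlt | hge
  · have hmem : T ∈ Finset.Icc T (T + ⌊T / L⌋₊) := by simp
    obtain ⟨hlower, -, hupper⟩ := hf T hmem
    calc (1 : ℝ) ≤ 16 * f T / (T + f T) / 2 := by
          rw [div_div, le_div_iff₀ (by linarith)]
          linarith
      _ ≤ ∑ k ∈ Finset.Icc T (T + ⌊T / L⌋₊), 16 * f k / (k + f k) / 2 := by
          refine Finset.single_le_sum (f := fun k : ℕ => 16 * f k / (k + f k) / 2)
            (fun _ hk => ?_) hmem
          have := (hf _ hk).1
          positivity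
  · have : (0 : ℝ) < T := by linarith
    have hcard : (T : ℝ) / L ≤ (Finset.Icc T (T + ⌊T / L⌋₊)).card := by
      rw [Nat.card_Icc, add_assoc, Nat.add_sub_cancel_left, Nat.cast_add_one]
      exact (Nat.lt_floor_add_one (T / L)).le
    calc (1 : ℝ) = T / L * (L / T) := by field_simp
      _ ≤ (Finset.Icc T (T + ⌊T / L⌋₊)).card * (L / T) := by gcongr
      _ = ∑ _k ∈ Finset.Icc T (T + ⌊T / L⌋₊), L / T := by rw [Finset.sum_const, nsmul_eq_mul]
      _ ≤ ∑ k ∈ Finset.Icc T (T + ⌊T / L⌋₊), 16 * f k / (k + f k) / 2 :=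
          Finset.sum_le_sum fun k hk =>
            div_le_block_term hL hge (hf k hk).1 (hf k hk).2.1 (hf k hk).2.2 hk

end Block

/-! ### Summation of the crossing probabilities -/

lemma exp_neg_le_inv_sq {z : ℝ} (hz : 0 ≤ z) : exp (-z) ≤ 24 / (1 + z ^ 2) ^ 2 := by
  have htaylor : 1 + z + z ^ 2 / 2 + z ^ 3 / 6 + z ^ 4 / 24 ≤ exp z := by
    simpa [Finset.sum_range_succ, Nat.factorial] using sum_le_exp_of_nonneg hz 5
  rw [le_div_iff₀ (by positivity), exp_neg, inv_mul_le_iff₀ (exp_pos _)]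
  nlinarith [pow_nonneg hz 3, pow_nonneg hz 2]

lemma sum_inv_sq_le {c : ℝ} (hc : 0 < c) (n : ℕ) :
    ∑ k ∈ Finset.Icc 1 n, 1 / (1 + c * k) ^ 2 ≤ 1 / c := by
  have htelescope :
      ∑ k ∈ Finset.Icc 1 n, 1 / (1 + c * (k : ℝ)) ^ 2 ≤ 1 / c - 1 / (c * (1 + c * n)) := by
    induction n with
    | zero => simp
    | succ n ih =>
      have hstep : 1 / (1 + c * ((n : ℝ) + 1)) ^ 2
          ≤ 1 / (c * (1 + c * n)) - 1 / (c * (1 + c * ((n : ℝ) + 1))) := by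
        calc 1 / (1 + c * ((n : ℝ) + 1)) ^ 2
            ≤ 1 / ((1 + c * n) * (1 + c * (n + 1))) := by
              rw [sq]
              gcongr
              linarith
          _ = 1 / (c * (1 + c * n)) - 1 / (c * (1 + c * ((n : ℝ) + 1))) := by
              field_simp
              ring
      rw [Finset.sum_Icc_succ_top (by omega), Nat.cast_add_one]
      linarith
  have : 0 ≤ 1 / (c * (1 + c * n)) := by positivity
  linarith

lemma sum_inv_sqrt_le (n : ℕ) : ∑ k ∈ Finset.Icc 1 n, 1 / √k ≤ 2 * √n := by
  induction n with
  | zero => simp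
  | succ n ih =>
    have hstep : 1 / √((n : ℝ) + 1) ≤ 2 * √((n : ℝ) + 1) - 2 * √n := by
      rw [div_le_iff₀ (by positivity)]
      nlinarith [sq_nonneg (√((n : ℝ) + 1) - √n), sq_sqrt (by positivity : 0 ≤ (n : ℝ) + 1),
        sq_sqrt (n.cast_nonneg : (0 : ℝ) ≤ n)]
    rw [Finset.sum_Icc_succ_top (by omega), Nat.cast_add_one]
    linarith

section BoundaryTerm

variable {s y : ℝ}

lemma boundary_term_le_of_le_one (hy : 0 < y) (hs : 0 < s) (hs1 : s ≤ 1) :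
    (y - log s) * exp (-(√(s * (y - log s)) / 2))
      ≤ 24 * y * (1 / (1 + y / 4 * s) ^ 2) + 2 / √s := by
  have hlog_nonpos : log s ≤ 0 := log_nonpos hs.le hs1
  have hlog : -log s ≤ 2 / √s := by
    have htangent := log_le_sub_one_of_pos (by positivity : 0 < 1 / √s)
    rw [one_div, log_inv, log_sqrt hs.le] at htangent
    rw [div_eq_mul_inv]
    linarith
  have hexp : exp (-(√(s * y) / 2)) ≤ 24 * (1 / (1 + y / 4 * s) ^ 2) := by
    rw [mul_one_div, show y / 4 * s = (√(s * y) / 2) ^ 2 by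
      rw [div_pow, sq_sqrt (by positivity)]; ring]
    exact exp_neg_le_inv_sq (by positivity)
  have hexp_le_one : exp (-(√(s * y) / 2)) ≤ 1 :=
    exp_le_one_iff.2 (neg_nonpos.2 (by positivity))
  calc (y - log s) * exp (-(√(s * (y - log s)) / 2))
      ≤ (y + 2 / √s) * exp (-(√(s * y) / 2)) := by
        gcongr <;> linarith
    _ = y * exp (-(√(s * y) / 2)) + 2 / √s * exp (-(√(s * y) / 2)) := by ring
    _ ≤ y * (24 * (1 / (1 + y / 4 * s) ^ 2)) + 2 / √s * 1 := by gcongr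
    _ = 24 * y * (1 / (1 + y / 4 * s) ^ 2) + 2 / √s := by ring

lemma mul_exp_neg_half_sqrt_le {L : ℝ} (hL : 0 ≤ L) : L * exp (-(√L / 2)) ≤ 8 := by
  have hquad := quadratic_le_exp_of_nonneg (x := √L / 2) (by positivity)
  rw [exp_neg, mul_inv_le_iff₀ (exp_pos _)]
  nlinarith [sq_sqrt hL, sqrt_nonneg L]

lemma boundary_term_le (hy : 0 < y) (hs : 0 < s) (hL : 0 ≤ y - log s) :
    (y - log s) * (exp (-(√(s * (y - log s)) / 2)) * exp (-(s / 8)))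
      ≤ 24 * y * (1 / (1 + y / 4 * s) ^ 2) + (if s ≤ 1 then 2 / √s else 0)
        + 8 * exp (-(s / 8)) := by
  split_ifs with hs1
  · have hexp : exp (-(s / 8)) ≤ 1 := exp_le_one_iff.2 (by linarith)
    calc (y - log s) * (exp (-(√(s * (y - log s)) / 2)) * exp (-(s / 8)))
        ≤ (y - log s) * (exp (-(√(s * (y - log s)) / 2)) * 1) := by gcongr
      _ ≤ 24 * y * (1 / (1 + y / 4 * s) ^ 2) + 2 / √s := by
          rw [mul_one]
          exact boundary_term_le_of_le_one hy hs hs1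
      _ ≤ 24 * y * (1 / (1 + y / 4 * s) ^ 2) + 2 / √s + 8 * exp (-(s / 8)) :=
          le_add_of_nonneg_right (by positivity)
  · calc (y - log s) * (exp (-(√(s * (y - log s)) / 2)) * exp (-(s / 8)))
        ≤ (y - log s) * (exp (-(√(y - log s) / 2)) * exp (-(s / 8))) := by
          gcongr
          exact le_mul_of_one_le_left hL (not_le.1 hs1).le
      _ = (y - log s) * exp (-(√(y - log s) / 2)) * exp (-(s / 8)) := by ring
      _ ≤ 8 * exp (-(s / 8)) := by
          gcongr
          exact mul_exp_neg_half_sqrt_le hL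
      _ ≤ 24 * y * (1 / (1 + y / 4 * s) ^ 2) + 0 + 8 * exp (-(s / 8)) :=
          le_add_of_nonneg_left (by positivity)

end BoundaryTerm

section BoundarySum

variable {ε y : ℝ}

lemma sum_log_term_le (hε : 0 < ε) (hy : 0 < y) (n : ℕ) :
    ∑ k ∈ Finset.Icc 1 n, 24 * y * (1 / (1 + y / 4 * (ε ^ 2 * k)) ^ 2) ≤ 96 / ε ^ 2 := by
  simp_rw [← mul_assoc (y / 4)]
  rw [← Finset.mul_sum]
  calc 24 * y * ∑ k ∈ Finset.Icc 1 n, 1 / (1 + y / 4 * ε ^ 2 * (k : ℝ)) ^ 2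
      ≤ 24 * y * (1 / (y / 4 * ε ^ 2)) := by
        gcongr
        exact sum_inv_sq_le (by positivity) n
    _ = 96 / ε ^ 2 := by
        field_simp
        norm_num

lemma sum_short_time_term_le (hε : 0 < ε) (n : ℕ) :
    ∑ k ∈ Finset.Icc 1 n, (if ε ^ 2 * (k : ℝ) ≤ 1 then 2 / √(ε ^ 2 * k) else 0) ≤ 4 / ε ^ 2 := by
  have hsubset : (Finset.Icc 1 n).filter (fun k : ℕ => ε ^ 2 * k ≤ 1)
      ⊆ Finset.Icc 1 ⌊1 / ε ^ 2⌋₊ := by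
    intro k hk
    obtain ⟨hk, hk_le⟩ := Finset.mem_filter.1 hk
    refine Finset.mem_Icc.2 ⟨(Finset.mem_Icc.1 hk).1, Nat.le_floor ?_⟩
    rwa [le_div_iff₀ (by positivity), mul_comm]
  have hsqrt : √(⌊1 / ε ^ 2⌋₊ : ℝ) ≤ 1 / ε := by
    rw [sqrt_le_left (by positivity), div_pow, one_pow]
    exact Nat.floor_le (by positivity)
  rw [← Finset.sum_filter]
  calc ∑ k ∈ Finset.Icc 1 n with ε ^ 2 * (k : ℕ) ≤ 1, 2 / √(ε ^ 2 * (k : ℝ))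
      ≤ ∑ k ∈ Finset.Icc 1 ⌊1 / ε ^ 2⌋₊, 2 / √(ε ^ 2 * (k : ℝ)) :=
        Finset.sum_le_sum_of_subset_of_nonneg hsubset fun k _ _ => by positivity
    _ = 2 / ε * ∑ k ∈ Finset.Icc 1 ⌊1 / ε ^ 2⌋₊, 1 / √(k : ℝ) := by
        rw [Finset.mul_sum]
        refine Finset.sum_congr rfl fun k _ => ?_
        rw [sqrt_mul (sq_nonneg ε), sqrt_sq hε.le, div_mul_div_comm, mul_one]
    _ ≤ 2 / ε * (2 * (1 / ε)) := by
        gcongr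
        exact (sum_inv_sqrt_le _).trans (by gcongr)
    _ = 4 / ε ^ 2 := by
        field_simp
        norm_num

lemma sum_long_time_term_le (hε : 0 < ε) (n : ℕ) :
    ∑ k ∈ Finset.Icc 1 n, 8 * exp (-(ε ^ 2 * k / 8)) ≤ 64 / ε ^ 2 := by
  rw [← Finset.mul_sum, ← Finset.Ico_add_one_right_eq_Icc]
  simp_rw [← div_mul_eq_mul_div]
  calc 8 * ∑ k ∈ Finset.Ico 1 (n + 1), exp (-(ε ^ 2 / 8 * (k : ℝ)))
      ≤ 8 * (1 / (ε ^ 2 / 8)) := by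
        gcongr
        exact sum_exp_neg_mul_le (by positivity) _
    _ = 64 / ε ^ 2 := by
        field_simp
        norm_num

lemma sum_boundary_term_le (hε : 0 < ε) (hy : 0 < y) (n : ℕ) :
    ∑ k ∈ Finset.Icc 1 n with 1 ≤ y - log (ε ^ 2 * (k : ℕ)),
      (y - log (ε ^ 2 * k)) * (exp (-(√(ε ^ 2 * k * (y - log (ε ^ 2 * k))) / 2))
        * exp (-(ε ^ 2 * k / 8))) ≤ 164 / ε ^ 2 := by
  set log_term : ℕ → ℝ := fun k => 24 * y * (1 / (1 + y / 4 * (ε ^ 2 * k)) ^ 2)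
  set short_time : ℕ → ℝ := fun k => if ε ^ 2 * (k : ℝ) ≤ 1 then 2 / √(ε ^ 2 * k) else 0
  set long_time : ℕ → ℝ := fun k => 8 * exp (-(ε ^ 2 * k / 8))
  calc ∑ k ∈ Finset.Icc 1 n with 1 ≤ y - log (ε ^ 2 * (k : ℕ)),
        (y - log (ε ^ 2 * k)) * (exp (-(√(ε ^ 2 * k * (y - log (ε ^ 2 * k))) / 2))
          * exp (-(ε ^ 2 * k / 8)))
      ≤ ∑ k ∈ Finset.Icc 1 n with 1 ≤ y - log (ε ^ 2 * (k : ℕ)),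
          (log_term k + short_time k + long_time k) := by
        refine Finset.sum_le_sum fun k hk => ?_
        obtain ⟨hk, hL⟩ := Finset.mem_filter.1 hk
        have : (0 : ℝ) < k := by exact_mod_cast (Finset.mem_Icc.1 hk).1
        exact boundary_term_le hy (by positivity) (by linarith)
    _ ≤ ∑ k ∈ Finset.Icc 1 n, (log_term k + short_time k + long_time k) := by
        refine Finset.sum_le_sum_of_subset_of_nonneg (Finset.filter_subset _ _) fun k _ _ => ?_
        have : 0 ≤ short_time k := ite_nonneg (by positivity) le_rfl
        positivity
    _ = ∑ k ∈ Finset.Icc 1 n, log_term k + ∑ k ∈ Finset.Icc 1 n, short_time k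
        + ∑ k ∈ Finset.Icc 1 n, long_time k := by
        rw [Finset.sum_add_distrib, Finset.sum_add_distrib]
    _ ≤ 96 / ε ^ 2 + 4 / ε ^ 2 + 64 / ε ^ 2 :=
        add_le_add (add_le_add (sum_log_term_le hε hy n) (sum_short_time_term_le hε n))
          (sum_long_time_term_le hε n)
    _ = 164 / ε ^ 2 := by ring

end BoundarySum

/-! ### The index of an arm is rarely much smaller than its mean -/

lemma natCast_inv_eq_sq (T : ℕ) : (T : ℝ≥0)⁻¹ = (NNReal.sqrt T)⁻¹ ^ 2 := by
  rw [inv_pow, NNReal.sq_sqrt]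

lemma sqrt_natCast_pos {T : ℕ} (hT : 1 ≤ T) : 0 < NNReal.sqrt T :=
  NNReal.sqrt_pos.2 (by exact_mod_cast hT)

lemma le_gittinsIndex_inv (ν : ℝ) {T m : ℕ} (hT : 1 ≤ T) (hm : 1 ≤ m) :
    ν ≤ gittinsIndex ν (T : ℝ≥0)⁻¹ m := by
  rw [natCast_inv_eq_sq]
  exact le_gittinsIndex ν (inv_pos.2 (sqrt_natCast_pos hT)) hm

lemma add_div_sqrt_le_gittinsIndex (ν : ℝ) {x : ℝ} {T m : ℕ} (hT : 1 ≤ T) (hx : 1 ≤ x)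
    (hm : lowerIndexConst * (exp (x ^ 2 / 2) * (x * (T + x ^ 2))) ≤ m) :
    ν + x / √T ≤ gittinsIndex ν (T : ℝ≥0)⁻¹ m := by
  have hsqrt : (NNReal.sqrt T : ℝ) = √T := by rw [Real.coe_sqrt, NNReal.coe_natCast]
  rw [natCast_inv_eq_sq, ← hsqrt]
  refine add_div_le_gittinsIndex ν (NNReal.one_le_sqrt.2 (by exact_mod_cast hT)) hx ?_
  rwa [hsqrt, sq_sqrt T.cast_nonneg]

/-- The constant in the relation between the horizon and the argument `L` of `halfSq`: it exceeds
`lowerIndexConst` by the factor that `exp_halfSq_mul_le` loses. -/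
def horizonConst : ℝ := 3 * lowerIndexConst

lemma one_le_horizonConst : 1 ≤ horizonConst := by
  unfold horizonConst
  linarith [one_le_lowerIndexConst]

lemma horizonConst_pos : 0 < horizonConst := zero_lt_one.trans_le one_le_horizonConst

/-- The logarithmic horizon `L` of an arm with `k` plays when `m` rounds remain, defined by
`m = horizonConst * k * exp L`. -/
def logHorizon (m k : ℕ) : ℝ := log (m / (horizonConst * k))

/-- The level that `w` has to exceed at time `k` for the arm with empirical mean `μ - w / k` to have
an index below `μ - ε`, up to the slack that lets a crossing at an earlier time `T` of the block
`[T, T + T / L]` be charged to time `k`. -/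
def boundary (m : ℕ) (ε : ℝ) (k : ℕ) : ℝ :=
  ε * k / 2 + √(2 * (halfSq (logHorizon m k) k - 3)) * √k

/-- The times at which the crossings of `boundary` have to be controlled. -/
def boundaryTimes (m : ℕ) : Finset ℕ := {k ∈ Finset.Icc 1 (2 * m) | 20 ≤ logHorizon m k}

/-- The weighted probabilities of ending above `boundary` at the times in `boundaryTimes`. The
weights sum up to at least `2` over each block `[T, T + T / L]`. -/
def crossingPotential (m : ℕ) (ε : ℝ) (T : ℕ) (w : ℝ) : ENNReal :=
  ∑ k ∈ boundaryTimes m,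
    ENNReal.ofReal (16 * logHorizon m k / (k + logHorizon m k))
      * tailPotential k (boundary m ε k) T w

/-- An exponential supermartingale that is at least `1` if the walk exceeds `ε * T` at a time `T`
with `logHorizon m T < 21`. -/
def latePotential (m : ℕ) (ε : ℝ) (T : ℕ) (w : ℝ) : ENNReal :=
  ENNReal.ofReal (2 * (horizonConst * exp 21) / (m * ε ^ 2))
    * ENNReal.ofReal (exp (ε * w - ε ^ 2 / 2 * T))

section IndexPotential

variable {m k T : ℕ} {ε μ w : ℝ}

lemma isSuperharmonic_crossingPotential (m : ℕ) (ε : ℝ) :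
    IsSuperharmonic (crossingPotential m ε) :=
  IsSuperharmonic.sum fun _ _ => (isSuperharmonic_tailPotential _ _).const_mul _

lemma isSuperharmonic_latePotential (m : ℕ) (ε : ℝ) : IsSuperharmonic (latePotential m ε) :=
  (isSuperharmonic_exp ε).const_mul _

lemma horizonConst_mul_exp_logHorizon (hm : 1 ≤ m) (hk : 1 ≤ k) :
    horizonConst * k * exp (logHorizon m k) = m := by
  have hm0 : (0 : ℝ) < m := by exact_mod_cast hm
  have hk0 : (0 : ℝ) < k := by exact_mod_cast hk
  have hscale : 0 < horizonConst * k := mul_pos horizonConst_pos hk0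
  rw [logHorizon, exp_log (div_pos hm0 hscale), mul_div_cancel₀ _ hscale.ne']

lemma logHorizon_eq_sub (hε : 0 < ε) (hm : 1 ≤ m) (hk : 1 ≤ k) :
    logHorizon m k = log (m * ε ^ 2 / horizonConst) - log (ε ^ 2 * k) := by
  have : (0 : ℝ) < m := by exact_mod_cast hm
  have : (0 : ℝ) < k := by exact_mod_cast hk
  have := horizonConst_pos
  rw [logHorizon, ← log_div (by positivity) (by positivity)]
  congr 1
  field_simp

lemma logHorizon_eq_add (hm : 1 ≤ m) (hT : 1 ≤ T) (hk : 1 ≤ k) :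
    logHorizon m T = logHorizon m k + log (k / T) := by
  have : (0 : ℝ) < m := by exact_mod_cast hm
  have : (0 : ℝ) < T := by exact_mod_cast hT
  have : (0 : ℝ) < k := by exact_mod_cast hk
  have := horizonConst_pos
  rw [logHorizon, logHorizon, ← log_mul (by positivity) (by positivity)]
  congr 1
  field_simp

lemma boundary_pos (hε : 0 < ε) (hk : 1 ≤ k) : 0 < boundary m ε k := by
  unfold boundary
  positivity

end IndexPotential

section CrossingTerm

variable {L k ε : ℝ}

lemma sq_boundary_div (hk : 0 < k) (ε η : ℝ) :
    (ε * k / 2 + η * √k) ^ 2 / (2 * k) = ε ^ 2 * k / 8 + ε * √k * η / 2 + η ^ 2 / 2 := by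
  have hsq : √k ^ 2 = k := sq_sqrt hk.le
  rw [div_eq_iff (by positivity)]
  linear_combination η ^ 2 * hsq

lemma exp_boundary_sq_le (hL : 20 ≤ L) (hk : 1 ≤ k) (hε : 0 < ε) :
    exp (-(ε * k / 2 + √(2 * (halfSq L k - 3)) * √k) ^ 2 / (2 * k))
      ≤ exp (3 - halfSq L k) * (exp (-(√(ε ^ 2 * k * L) / 2)) * exp (-(ε ^ 2 * k / 8))) := by
  have hlower := le_halfSq hL hk
  have hsqrt : √(ε ^ 2 * k * L) ≤ ε * √k * √(2 * (halfSq L k - 3)) := by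
    rw [sqrt_mul (by positivity), sqrt_mul (by positivity), sqrt_sq hε.le]
    gcongr
    linarith
  rw [← exp_add, ← exp_add, exp_le_exp, neg_div, sq_boundary_div (by linarith),
    sq_sqrt (by linarith)]
  linarith

lemma sqrt_div_boundary_le (hL : 20 ≤ L) (hk : 1 ≤ k) (hε : 0 < ε) :
    √k / (ε * k / 2 + √(2 * (halfSq L k - 3)) * √k) ≤ 1 / √L := by
  have hlower := le_halfSq hL hk
  have hsqrt : √L * √k ≤ √(2 * (halfSq L k - 3)) * √k := by
    gcongr
    linarith
  have : 0 < √k := sqrt_pos.2 (by linarith)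
  have : 0 < √L := sqrt_pos.2 (by linarith)
  have : 0 < ε * k / 2 := by positivity
  rw [div_le_div_iff₀ (by positivity) (by positivity)]
  linarith

lemma crossing_term_le {A m : ℝ} (hA : 0 < A) (hL : 20 ≤ L) (hk : 1 ≤ k) (hm : A * k * exp L = m)
    (hε : 0 < ε) :
    16 * L / (k + L) * (√k / (ε * k / 2 + √(2 * (halfSq L k - 3)) * √k) *
        exp (-(ε * k / 2 + √(2 * (halfSq L k - 3)) * √k) ^ 2 / (2 * k)))
      ≤ 16 * exp 3 * A / m
        * (L * (exp (-(√(ε ^ 2 * k * L) / 2)) * exp (-(ε ^ 2 * k / 8)))) := by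
  have hk0 : 0 < k := by linarith
  have hL0 : 0 < L := by linarith
  have : 0 < √L := sqrt_pos.2 hL0
  have hexp : exp (3 - halfSq L k) = exp 3 * (√L * (k + L)) / (exp L * k) := by
    rw [exp_sub, exp_halfSq hL0 hk0, div_div_eq_mul_div]
  calc 16 * L / (k + L) * (√k / (ε * k / 2 + √(2 * (halfSq L k - 3)) * √k) *
        exp (-(ε * k / 2 + √(2 * (halfSq L k - 3)) * √k) ^ 2 / (2 * k)))
      ≤ 16 * L / (k + L) * (1 / √L * (exp (3 - halfSq L k) *
          (exp (-(√(ε ^ 2 * k * L) / 2)) * exp (-(ε ^ 2 * k / 8))))) := by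
        refine mul_le_mul_of_nonneg_left (mul_le_mul (sqrt_div_boundary_le hL hk hε)
          (exp_boundary_sq_le hL hk hε) (exp_pos _).le (by positivity)) (by positivity)
    _ = 16 * exp 3 * A / m
        * (L * (exp (-(√(ε ^ 2 * k * L) / 2)) * exp (-(ε ^ 2 * k / 8)))) := by
        rw [hexp, ← hm]
        field_simp

end CrossingTerm

section IndexPotential

variable {m T : ℕ} {ε μ w : ℝ}

lemma crossingPotential_summand_zero_le (hm : 1 ≤ m) (hε : 0 < ε) {k : ℕ}
    (hk : k ∈ boundaryTimes m) :
    ENNReal.ofReal (16 * logHorizon m k / (k + logHorizon m k))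
        * tailPotential k (boundary m ε k) 0 0
      ≤ ENNReal.ofReal (16 * exp 3 * horizonConst / m * (logHorizon m k *
        (exp (-(√(ε ^ 2 * k * logHorizon m k) / 2)) * exp (-(ε ^ 2 * k / 8))))) := by
  obtain ⟨hk, hL⟩ := Finset.mem_filter.1 hk
  have hk := (Finset.mem_Icc.1 hk).1
  calc ENNReal.ofReal (16 * logHorizon m k / (k + logHorizon m k))
        * tailPotential k (boundary m ε k) 0 0
      ≤ ENNReal.ofReal (16 * logHorizon m k / (k + logHorizon m k))
        * ENNReal.ofReal (√k / boundary m ε k * exp (-boundary m ε k ^ 2 / (2 * k))) := by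
        gcongr
        exact tailPotential_zero_le hk (boundary_pos hε hk)
    _ ≤ _ := by
        rw [← ENNReal.ofReal_mul (by positivity)]
        exact ENNReal.ofReal_le_ofReal (crossing_term_le horizonConst_pos hL
          (by exact_mod_cast hk) (horizonConst_mul_exp_logHorizon hm hk) hε)

lemma sum_boundaryTimes_le (hm : 1 ≤ m) (hε : 0 < ε) (hlarge : horizonConst < m * ε ^ 2) :
    ∑ k ∈ boundaryTimes m, logHorizon m k *
      (exp (-(√(ε ^ 2 * k * logHorizon m k) / 2)) * exp (-(ε ^ 2 * k / 8))) ≤ 164 / ε ^ 2 := by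
  set y := log (m * ε ^ 2 / horizonConst)
  have hlog {k : ℕ} (hk : k ∈ boundaryTimes m) : logHorizon m k = y - log (ε ^ 2 * k) :=
    logHorizon_eq_sub hε hm (Finset.mem_Icc.1 (Finset.mem_filter.1 hk).1).1
  have hsubset : boundaryTimes m
      ⊆ {k ∈ Finset.Icc 1 (2 * m) | 1 ≤ y - log (ε ^ 2 * (k : ℕ))} := fun k hk =>
    Finset.mem_filter.2 ⟨(Finset.mem_filter.1 hk).1, by
      linarith [hlog hk, (Finset.mem_filter.1 hk).2]⟩
  calc ∑ k ∈ boundaryTimes m, logHorizon m k *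
        (exp (-(√(ε ^ 2 * k * logHorizon m k) / 2)) * exp (-(ε ^ 2 * k / 8)))
      = ∑ k ∈ boundaryTimes m, (y - log (ε ^ 2 * k)) *
          (exp (-(√(ε ^ 2 * k * (y - log (ε ^ 2 * k))) / 2)) * exp (-(ε ^ 2 * k / 8))) :=
        Finset.sum_congr rfl fun k hk => by rw [hlog hk]
    _ ≤ ∑ k ∈ Finset.Icc 1 (2 * m) with 1 ≤ y - log (ε ^ 2 * (k : ℕ)), (y - log (ε ^ 2 * k)) *
          (exp (-(√(ε ^ 2 * k * (y - log (ε ^ 2 * k))) / 2)) * exp (-(ε ^ 2 * k / 8))) := by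
        refine Finset.sum_le_sum_of_subset_of_nonneg hsubset fun k hk _ => ?_
        have := (Finset.mem_filter.1 hk).2
        positivity
    _ ≤ 164 / ε ^ 2 :=
        sum_boundary_term_le hε (log_pos ((one_lt_div horizonConst_pos).2 hlarge)) _

lemma crossingPotential_zero_le (hm : 1 ≤ m) (hε : 0 < ε) (hlarge : horizonConst < m * ε ^ 2) :
    crossingPotential m ε 0 0
      ≤ ENNReal.ofReal (16 * exp 3 * horizonConst * 164 / (m * ε ^ 2)) := by
  have := horizonConst_pos
  refine (Finset.sum_le_sum fun k hk => crossingPotential_summand_zero_le hm hε hk).trans ?_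
  rw [← ENNReal.ofReal_sum_of_nonneg fun k hk => by
      have := (Finset.mem_filter.1 hk).2
      positivity,
    ← Finset.mul_sum, ← div_mul_div_comm]
  gcongr
  exact sum_boundaryTimes_le hm hε hlarge

lemma one_le_latePotential (hm : 1 ≤ m) (hε : 0 < ε) (hT : 1 ≤ T) (hlate : logHorizon m T < 21)
    (hw : ε * T < w) : 1 ≤ latePotential m ε T w := by
  have hm0 : (0 : ℝ) < m := by exact_mod_cast hm
  have hA := horizonConst_pos
  have hmT : (m : ℝ) ≤ horizonConst * T * exp 21 := by
    rw [← horizonConst_mul_exp_logHorizon hm hT]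
    gcongr
  have hexp : ε ^ 2 * T / 2 ≤ exp (ε * w - ε ^ 2 / 2 * T) := by
    nlinarith [add_one_le_exp (ε * w - ε ^ 2 / 2 * T)]
  rw [latePotential, ← ENNReal.ofReal_mul (by positivity), ENNReal.one_le_ofReal]
  calc 1 ≤ horizonConst * T * exp 21 / m := (one_le_div hm0).2 hmT
    _ = 2 * (horizonConst * exp 21) / (m * ε ^ 2) * (ε ^ 2 * T / 2) := by field_simp
    _ ≤ 2 * (horizonConst * exp 21) / (m * ε ^ 2) * exp (ε * w - ε ^ 2 / 2 * T) := by gcongr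

lemma lt_of_gittinsIndex_lt (hm : 1 ≤ m) (hT : 1 ≤ T)
    (h : gittinsIndex (μ - w / T) (T : ℝ≥0)⁻¹ m < μ - ε) : ε * T < w := by
  have hmean := (le_gittinsIndex_inv (μ - w / T) hT hm).trans_lt h
  rw [← lt_div_iff₀ (by exact_mod_cast hT)]
  linarith

lemma lt_of_gittinsIndex_lt_of_le_logHorizon (hm : 1 ≤ m) (hT : 1 ≤ T) (hL : 20 ≤ logHorizon m T)
    (h : gittinsIndex (μ - w / T) (T : ℝ≥0)⁻¹ m < μ - ε) :
    ε * T + √(2 * halfSq (logHorizon m T) T) * √T < w := by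
  have hT1 : (1 : ℝ) ≤ T := by exact_mod_cast hT
  set x := √(2 * halfSq (logHorizon m T) T)
  have hx1 : 1 ≤ x := one_le_sqrt.2 (by linarith [le_halfSq hL hT1])
  have hhorizon : lowerIndexConst * (exp (x ^ 2 / 2) * (x * (T + x ^ 2))) ≤ m := by
    calc lowerIndexConst * (exp (x ^ 2 / 2) * (x * (T + x ^ 2)))
        ≤ lowerIndexConst * (3 * (exp (logHorizon m T) * T)) :=
          mul_le_mul_of_nonneg_left (exp_halfSq_mul_le hL hT1)
            (zero_le_one.trans one_le_lowerIndexConst)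
      _ = horizonConst * T * exp (logHorizon m T) := by
          unfold horizonConst
          ring
      _ = m := horizonConst_mul_exp_logHorizon hm hT
  have hindex := (add_div_sqrt_le_gittinsIndex (μ - w / T) hT hx1 hhorizon).trans_lt h
  have hmean : ε + x / √T < w / T := by linarith
  rw [lt_div_iff₀ (by linarith)] at hmean
  rwa [add_mul, div_mul_eq_mul_div, mul_div_assoc, div_sqrt] at hmean

lemma logHorizon_mem_block (hm : 1 ≤ m) (hT : 1 ≤ T) {k : ℕ} (hTk : T ≤ k) (hk : (k : ℝ) ≤ 2 * T) :
    logHorizon m k ≤ logHorizon m T ∧ logHorizon m T ≤ logHorizon m k + 1 := by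
  have hT0 : (0 : ℝ) < T := by exact_mod_cast hT
  have hTk' : (T : ℝ) ≤ k := by exact_mod_cast hTk
  have hlog := logHorizon_eq_add hm hT (hT.trans hTk)
  have hlog_nonneg : 0 ≤ log ((k : ℝ) / T) := log_nonneg ((one_le_div hT0).2 hTk')
  have hlog_le : log ((k : ℝ) / T) ≤ log 2 :=
    log_le_log (div_pos (by linarith) hT0) ((div_le_iff₀ hT0).2 hk)
  constructor <;> linarith [log_two_lt_d9]

lemma le_of_zero_le_logHorizon (hm : 1 ≤ m) (hT : 1 ≤ T) (hL : 0 ≤ logHorizon m T) : T ≤ m := by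
  have hle : (1 * T * 1 : ℝ) ≤ horizonConst * T * exp (logHorizon m T) := by
    have := horizonConst_pos
    gcongr
    · exact one_le_horizonConst
    · exact one_le_exp hL
  rw [horizonConst_mul_exp_logHorizon hm hT, one_mul, mul_one] at hle
  exact_mod_cast hle

lemma half_le_weight_mul_tailPotential {k : ℕ} (hTk : T ≤ k) (hL : 0 ≤ logHorizon m k)
    (hw : boundary m ε k ≤ w) :
    ENNReal.ofReal (16 * logHorizon m k / (k + logHorizon m k) / 2)
      ≤ ENNReal.ofReal (16 * logHorizon m k / (k + logHorizon m k))
        * tailPotential k (boundary m ε k) T w := by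
  rw [div_eq_mul_one_div _ (2 : ℝ), ENNReal.ofReal_mul (by positivity)]
  gcongr
  rw [ENNReal.ofReal_div_of_pos two_pos, ENNReal.ofReal_one, ENNReal.ofReal_ofNat]
  exact half_le_tailPotential hTk hw

lemma one_le_crossingPotential (hm : 1 ≤ m) (hε : 0 < ε) (hT : 1 ≤ T) (hL : 21 ≤ logHorizon m T)
    (hw : ε * T + √(2 * halfSq (logHorizon m T) T) * √T ≤ w) :
    1 ≤ crossingPotential m ε T w := by
  set L := logHorizon m
  set B := Finset.Icc T (T + ⌊T / L T⌋₊)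
  have hk_le {k : ℕ} (hk : k ∈ B) : (k : ℝ) ≤ T + T / L T :=
    cast_le_add_div_of_mem_block (by linarith) hk
  have hk_two {k : ℕ} (hk : k ∈ B) : (k : ℝ) ≤ 2 * T := by
    linarith [hk_le hk, div_le_self (T.cast_nonneg : (0 : ℝ) ≤ T) (by linarith : 1 ≤ L T)]
  have hTk {k : ℕ} (hk : k ∈ B) : T ≤ k := (Finset.mem_Icc.1 hk).1
  have hlog : ∀ k ∈ B, 20 ≤ L k ∧ L k ≤ L T ∧ L T ≤ L k + 1 := fun k hk => by
    obtain ⟨hle, hge⟩ := logHorizon_mem_block hm hT (hTk hk) (hk_two hk)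
    exact ⟨by linarith, hle, hge⟩
  have hsubset : B ⊆ boundaryTimes m := fun k hk => by
    have hTm : T ≤ m := le_of_zero_le_logHorizon hm hT (by linarith)
    have hk2 : k ≤ 2 * T := by exact_mod_cast hk_two hk
    exact Finset.mem_filter.2
      ⟨Finset.mem_Icc.2 ⟨hT.trans (hTk hk), by omega⟩, (hlog k hk).1⟩
  have hboundary {k : ℕ} (hk : k ∈ B) : boundary m ε k ≤ w :=
    (boundary_block_le (hlog k hk).1 (by exact_mod_cast hT) (hlog k hk).2.1 (hlog k hk).2.2
      (by exact_mod_cast hTk hk) (hk_le hk) hε.le).trans hw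
  calc 1 ≤ ENNReal.ofReal (∑ k ∈ B, 16 * L k / (k + L k) / 2) :=
        ENNReal.one_le_ofReal.2 (one_le_block_sum hL hlog)
    _ = ∑ k ∈ B, ENNReal.ofReal (16 * L k / (k + L k) / 2) :=
        ENNReal.ofReal_sum_of_nonneg fun k hk => by
          have := (hlog k hk).1
          positivity
    _ ≤ ∑ k ∈ B, ENNReal.ofReal (16 * L k / (k + L k)) * tailPotential k (boundary m ε k) T w :=
        Finset.sum_le_sum fun k hk => half_le_weight_mul_tailPotential (hTk hk)
          (by linarith [(hlog k hk).1]) (hboundary hk)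
    _ ≤ crossingPotential m ε T w := Finset.sum_le_sum_of_subset hsubset

/-- The constant in the bound on the probability that the index of an arm ever falls short of its
mean by a given amount. -/
def indexFailureConst : ℝ :=
  2 * (horizonConst * exp 21) + 16 * exp 3 * horizonConst * 164 + horizonConst

lemma indexFailureConst_pos : 0 < indexFailureConst := by
  have := horizonConst_pos
  unfold indexFailureConst
  positivity

lemma late_add_crossing_zero_le (hm : 1 ≤ m) (hε : 0 < ε) (hlarge : horizonConst < m * ε ^ 2) :
    (latePotential m ε + crossingPotential m ε) 0 0
      ≤ ENNReal.ofReal (indexFailureConst / (m * ε ^ 2)) := by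
  have hA := horizonConst_pos
  have hlate : latePotential m ε 0 0
      = ENNReal.ofReal (2 * (horizonConst * exp 21) / (m * ε ^ 2)) := by
    simp [latePotential]
  calc (latePotential m ε + crossingPotential m ε) 0 0
      ≤ ENNReal.ofReal (2 * (horizonConst * exp 21) / (m * ε ^ 2))
        + ENNReal.ofReal (16 * exp 3 * horizonConst * 164 / (m * ε ^ 2)) :=
        add_le_add hlate.le (crossingPotential_zero_le hm hε hlarge)
    _ = ENNReal.ofReal
        ((2 * (horizonConst * exp 21) + 16 * exp 3 * horizonConst * 164) / (m * ε ^ 2)) := by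
        rw [← ENNReal.ofReal_add (by positivity) (by positivity), ← add_div]
    _ ≤ ENNReal.ofReal (indexFailureConst / (m * ε ^ 2)) := by
        gcongr
        exact le_add_of_nonneg_right hA.le

theorem exists_isSuperharmonic_one_le_of_gittinsIndex_lt (hm : 1 ≤ m) (hε : 0 < ε) :
    ∃ V : ℕ → ℝ → ENNReal, IsSuperharmonic V ∧
      V 0 0 ≤ ENNReal.ofReal (indexFailureConst / (m * ε ^ 2)) ∧
      ∀ (μ : ℝ) (T : ℕ) (w : ℝ), 1 ≤ T →
        gittinsIndex (μ - w / T) (T : ℝ≥0)⁻¹ m < μ - ε → 1 ≤ V T w := by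
  have : (0 : ℝ) < m := by exact_mod_cast hm
  rcases le_or_gt (m * ε ^ 2) horizonConst with hsmall | hlarge
  · refine ⟨fun _ _ => 1, isSuperharmonic_const 1, ?_, fun _ _ _ _ _ => le_rfl⟩
    rw [ENNReal.one_le_ofReal, one_le_div (by positivity)]
    refine hsmall.trans (le_add_of_nonneg_left ?_)
    have := horizonConst_pos
    positivity
  · refine ⟨latePotential m ε + crossingPotential m ε, ?_,
      late_add_crossing_zero_le hm hε hlarge, fun μ T w hT hindex => ?_⟩
    · simpa only [add_zero] using
        (isSuperharmonic_latePotential m ε).add (isSuperharmonic_crossingPotential m ε)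
    · rcases lt_or_ge (logHorizon m T) 21 with hlate | hearly
      · exact le_add_right
          (one_le_latePotential hm hε hT hlate (lt_of_gittinsIndex_lt hm hT hindex))
      · exact le_add_left (one_le_crossingPotential hm hε hT hearly
          (lt_of_gittinsIndex_lt_of_le_logHorizon hm hT (by linarith) hindex).le)

end IndexPotential

/-! ### Potentials along the plays of an arm -/

variable {Ω : Type*} {d : ℕ}

instance (μ : Fin d → ℝ) : IsMarkovKernel (rewardKernel μ) :=
  ⟨fun i => inferInstanceAs (IsProbabilityMeasure (gaussianReal (μ i) 1))⟩

/-- The sum of the deviations, with sign `e`, of the rewards of arm `i` from its mean. At each play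
of the arm it makes a step of the standard Gaussian random walk. -/
def armWalk (e : ℝ) (μ : Fin d → ℝ) (I : ℕ → Ω → Fin d) (X : ℕ → Ω → ℝ) (i : Fin d) (t : ℕ)
    (ω : Ω) : ℝ :=
  ∑ s ∈ Finset.range t, if I s ω = i then e * (X s ω - μ i) else 0

/-- `armCount` as a function of the history of the first `t` rounds. -/
def historyCount {t : ℕ} (i : Fin d) (g : Fin t → Fin d × ℝ) : ℕ :=
  ∑ s, if (g s).1 = i then 1 else 0

/-- `armWalk` as a function of the history of the first `t` rounds. -/
def historyWalk {t : ℕ} (e : ℝ) (μ : Fin d → ℝ) (i : Fin d) (g : Fin t → Fin d × ℝ) : ℝ :=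
  ∑ s, if (g s).1 = i then e * ((g s).2 - μ i) else 0

section Walk

variable {I : ℕ → Ω → Fin d} {X : ℕ → Ω → ℝ} {i : Fin d} {t : ℕ} {ω : Ω}

lemma armCount_eq_sum (I : ℕ → Ω → Fin d) (i : Fin d) (t : ℕ) (ω : Ω) :
    armCount I i t ω = ∑ s ∈ Finset.range t, if I s ω = i then 1 else 0 :=
  Finset.card_filter _ _

lemma armCount_succ (I : ℕ → Ω → Fin d) (i : Fin d) (t : ℕ) (ω : Ω) :
    armCount I i (t + 1) ω = armCount I i t ω + if I t ω = i then 1 else 0 := by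
  rw [armCount_eq_sum, armCount_eq_sum, Finset.sum_range_succ]

lemma armWalk_succ (e : ℝ) (μ : Fin d → ℝ) (I : ℕ → Ω → Fin d) (X : ℕ → Ω → ℝ) (i : Fin d) (t : ℕ)
    (ω : Ω) : armWalk e μ I X i (t + 1) ω
      = armWalk e μ I X i t ω + if I t ω = i then e * (X t ω - μ i) else 0 :=
  Finset.sum_range_succ _ _

lemma historyCount_history (I : ℕ → Ω → Fin d) (X : ℕ → Ω → ℝ) (i : Fin d) (t : ℕ) (ω : Ω) :
    historyCount i (history I X t ω) = armCount I i t ω := by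
  rw [armCount_eq_sum, Finset.sum_range]
  rfl

lemma historyWalk_history (e : ℝ) (μ : Fin d → ℝ) (I : ℕ → Ω → Fin d) (X : ℕ → Ω → ℝ) (i : Fin d)
    (t : ℕ) (ω : Ω) : historyWalk e μ i (history I X t ω) = armWalk e μ I X i t ω := by
  rw [armWalk, Finset.sum_range]
  rfl

lemma empMean_eq_add_armWalk_div {e : ℝ} (he : e ^ 2 = 1) (μ : Fin d → ℝ)
    (h : 1 ≤ armCount I i t ω) :
    empMean I X i t ω = μ i + e * (armWalk e μ I X i t ω / armCount I i t ω) := by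
  have hcount : (armCount I i t ω : ℝ) ≠ 0 := by positivity
  have hwalk : armWalk e μ I X i t ω
      = e * (∑ s ∈ Finset.range t with I s ω = i, X s ω - armCount I i t ω * μ i) := by
    rw [armWalk, ← Finset.sum_filter, ← Finset.mul_sum, Finset.sum_sub_distrib, Finset.sum_const,
      nsmul_eq_mul, armCount]
  rw [hwalk, mul_div_assoc, ← mul_assoc, ← sq, he, one_mul, sub_div, mul_div_cancel_left₀ _ hcount,
    add_sub_cancel, empMean]

lemma one_le_armCount (ht : d ≤ t) (hI : ∀ s < d, (I s ω : ℕ) = s) (i : Fin d) :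
    1 ≤ armCount I i t ω :=
  Finset.card_pos.2 ⟨i, Finset.mem_filter.2
    ⟨Finset.mem_range.2 (i.isLt.trans_le ht), Fin.ext (hI i i.isLt)⟩⟩

lemma measurableSet_history_fst_eq (s : Fin t) (i : Fin d) :
    MeasurableSet {g : Fin t → Fin d × ℝ | (g s).1 = i} :=
  (measurable_fst.comp (measurable_pi_apply s)) (measurableSet_singleton i)

lemma measurable_historyCount (t : ℕ) (i : Fin d) : Measurable (historyCount (t := t) i) :=
  Finset.measurable_fun_sum _ fun s _ =>
    .ite (measurableSet_history_fst_eq s i) measurable_const measurable_const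

lemma measurable_historyWalk (t : ℕ) (e : ℝ) (μ : Fin d → ℝ) (i : Fin d) :
    Measurable (historyWalk (t := t) e μ i) :=
  Finset.measurable_fun_sum _ fun s _ =>
    .ite (measurableSet_history_fst_eq s i) (by fun_prop) measurable_const

end Walk

lemma gaussianReal_map_signed {e : ℝ} (he : e ^ 2 = 1) (c : ℝ) :
    (gaussianReal c 1).map (fun x => e * (x - c)) = gaussianReal 0 1 := by
  have hcomp := Measure.map_map (μ := gaussianReal c 1) (measurable_const_mul e)
    (measurable_sub_const c)
  rw [gaussianReal_map_sub_const, gaussianReal_map_const_mul, sub_self, mul_zero] at hcomp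
  rw [← Function.comp_def (e * ·), ← hcomp]
  congr 1
  ext
  simp [he]

lemma lintegral_gaussianReal_signed {e : ℝ} (he : e ^ 2 = 1) (c : ℝ) {f : ℝ → ENNReal}
    (hf : Measurable f) :
    ∫⁻ x, f (e * (x - c)) ∂gaussianReal c 1 = ∫⁻ z, f z ∂gaussianReal 0 1 := by
  rw [← gaussianReal_map_signed he c, lintegral_map hf (by fun_prop)]

lemma measurable_uncurry_comp {α : Type*} [MeasurableSpace α] {V : ℕ → ℝ → ENNReal}
    (hV : ∀ T, Measurable (V T)) {f : α → ℕ} {g : α → ℝ} (hf : Measurable f) (hg : Measurable g) :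
    Measurable fun a => V (f a) (g a) :=
  (measurable_from_prod_countable_right hV : Measurable V.uncurry).comp (hf.prodMk hg)

namespace IsInteraction

variable [MeasurableSpace Ω] {P : Measure Ω} {μ : Fin d → ℝ} {n t : ℕ}
  {I : ℕ → Ω → Fin d} {X : ℕ → Ω → ℝ} {c V : ℕ → ℝ → ENNReal} {e : ℝ}

lemma measurableSet_arm_eq (h : IsInteraction P μ n I X) (t : ℕ) (i : Fin d) :
    MeasurableSet {ω | I t ω = i} :=
  h.measurable_arm t (measurableSet_singleton i)

lemma measurable_history (h : IsInteraction P μ n I X) (t : ℕ) : Measurable (history I X t) :=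
  measurable_pi_lambda _ fun s => (h.measurable_arm s).prodMk (h.measurable_reward s)

lemma measurable_armCount (h : IsInteraction P μ n I X) (i : Fin d) (t : ℕ) :
    Measurable (armCount I i t) := by
  simpa only [Function.comp_def, historyCount_history] using
    (measurable_historyCount t i).comp (h.measurable_history t)

lemma measurable_armWalk (h : IsInteraction P μ n I X) (e : ℝ) (i : Fin d) (t : ℕ) :
    Measurable (armWalk e μ I X i t) := by
  simpa only [Function.comp_def, historyWalk_history] using
    (measurable_historyWalk t e μ i).comp (h.measurable_history t)

lemma measurable_potential (h : IsInteraction P μ n I X) (hV : ∀ T, Measurable (V T)) (e : ℝ)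
    (i : Fin d) (t : ℕ) : Measurable fun ω => V (armCount I i t ω) (armWalk e μ I X i t ω) :=
  measurable_uncurry_comp hV (h.measurable_armCount i t) (h.measurable_armWalk e i t)

variable [IsProbabilityMeasure P]

lemma lintegral_reward (h : IsInteraction P μ n I X) (ht : t < n)
    {F : (Fin t → Fin d × ℝ) × Fin d → ℝ → ENNReal} (hF : Measurable F.uncurry) :
    ∫⁻ ω, F (history I X t ω, I t ω) (X t ω) ∂P
      = ∫⁻ ω, ∫⁻ x, F (history I X t ω, I t ω) x ∂gaussianReal (μ (I t ω)) 1 ∂P := by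
  have hpast : Measurable fun ω => (history I X t ω, I t ω) :=
    (h.measurable_history t).prodMk (h.measurable_arm t)
  calc ∫⁻ ω, F (history I X t ω, I t ω) (X t ω) ∂P
      = ∫⁻ p, F.uncurry p ∂P.map fun ω => ((history I X t ω, I t ω), X t ω) :=
        (lintegral_map hF (hpast.prodMk (h.measurable_reward t))).symm
    _ = ∫⁻ ω, ∫⁻ x, F (history I X t ω, I t ω) x ∂gaussianReal (μ (I t ω)) 1 ∂P := by
        rw [(h.reward_law t ht).map_eq, Measure.lintegral_compProd hF,
          lintegral_map hF.lintegral_kernel_prod_right' hpast]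
        rfl

lemma lintegral_potential_succ (h : IsInteraction P μ n I X) (i : Fin d) (he : e ^ 2 = 1)
    (hV : ∀ T, Measurable (V T)) (ht : t < n) :
    ∫⁻ ω, V (armCount I i (t + 1) ω) (armWalk e μ I X i (t + 1) ω) ∂P
      = ∫⁻ ω, if I t ω = i
          then ∫⁻ z, V (armCount I i t ω + 1) (armWalk e μ I X i t ω + z) ∂gaussianReal 0 1
          else V (armCount I i t ω) (armWalk e μ I X i t ω) ∂P := by
  let F : (Fin t → Fin d × ℝ) × Fin d → ℝ → ENNReal := fun p x =>
    V (historyCount i p.1 + if p.2 = i then 1 else 0)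
      (historyWalk e μ i p.1 + if p.2 = i then e * (x - μ i) else 0)
  have hset : MeasurableSet {p : ((Fin t → Fin d × ℝ) × Fin d) × ℝ | p.1.2 = i} :=
    (measurable_snd.comp measurable_fst) (measurableSet_singleton i)
  have hF : Measurable F.uncurry := measurable_uncurry_comp hV
    (((measurable_historyCount t i).comp (measurable_fst.comp measurable_fst)).add
      (.ite hset measurable_const measurable_const))
    (((measurable_historyWalk t e μ i).comp (measurable_fst.comp measurable_fst)).add
      (.ite hset (by fun_prop) measurable_const))
  have hmean := h.lintegral_reward ht hF
  simp only [F, historyCount_history, historyWalk_history, ← armCount_succ,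
    ← armWalk_succ] at hmean
  rw [hmean]
  refine lintegral_congr fun ω => ?_
  split_ifs with hi
  · rw [armCount_succ, if_pos hi, hi]
    exact lintegral_gaussianReal_signed he (μ i)
      ((hV (armCount I i t ω + 1)).comp (measurable_const_add (armWalk e μ I X i t ω)))
  · simp [armCount_succ, hi]

lemma setLIntegral_cost_add_lintegral_potential_succ_le (h : IsInteraction P μ n I X) (i : Fin d)
    (he : e ^ 2 = 1) (hV : IsPotential c V) (ht : t < n) :
    ∫⁻ ω in {ω | I t ω = i}, c (armCount I i t ω) (armWalk e μ I X i t ω) ∂P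
      + ∫⁻ ω, V (armCount I i (t + 1) ω) (armWalk e μ I X i (t + 1) ω) ∂P
      ≤ ∫⁻ ω, V (armCount I i t ω) (armWalk e μ I X i t ω) ∂P := by
  have harm := h.measurableSet_arm_eq t i
  rw [h.lintegral_potential_succ i he hV.measurable ht, ← lintegral_indicator harm,
    ← lintegral_add_left ((h.measurable_potential hV.measurable_cost e i t).indicator harm)]
  refine lintegral_mono fun ω => ?_
  by_cases hi : I t ω = i
  · simpa only [indicator_of_mem (show ω ∈ {ω | I t ω = i} from hi), if_pos hi] using
      hV.cost_add_mean_le _ _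
  · simp only [indicator_of_notMem (show ω ∉ {ω | I t ω = i} from hi), if_neg hi, zero_add, le_refl]

lemma sum_setLIntegral_cost_add_lintegral_potential_le (h : IsInteraction P μ n I X) (i : Fin d)
    (he : e ^ 2 = 1) (hV : IsPotential c V) (ht : t ≤ n) :
    ∑ s ∈ Finset.range t,
        ∫⁻ ω in {ω | I s ω = i}, c (armCount I i s ω) (armWalk e μ I X i s ω) ∂P
      + ∫⁻ ω, V (armCount I i t ω) (armWalk e μ I X i t ω) ∂P ≤ V 0 0 := by
  induction t with
  | zero => simp [armCount, armWalk]
  | succ t ih =>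
    rw [Finset.sum_range_succ, add_assoc]
    have hstep := h.setLIntegral_cost_add_lintegral_potential_succ_le i he hV ht
    exact (add_le_add_right hstep _).trans (ih (Nat.le_of_succ_le ht))

end IsInteraction

/-! ### The plays of an arm with too large an index -/

/-- The cost charged at a play of an arm that has been played fewer than `K` times. -/
def initialPlayCost (K : ℕ) (T : ℕ) (_w : ℝ) : ENNReal := if T < K then 1 else 0

/-- The number of plays that are still to be charged by `initialPlayCost`. -/
def initialPlayPotential (K : ℕ) (T : ℕ) (_w : ℝ) : ENNReal := (K - T : ℕ)

/-- The cost charged at a play of an arm whose empirical mean exceeds its mean by `δ`. -/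
def excessCost (δ : ℝ) (T : ℕ) (w : ℝ) : ENNReal := if T * δ ≤ w then 1 else 0

/-- An exponential potential for `excessCost`: without charges it decays by the factor
`exp (-δ ^ 2 / 2)` in each step, so that a geometric series pays for all charges. -/
def excessPotential (δ : ℝ) (T : ℕ) (w : ℝ) : ENNReal :=
  ENNReal.ofReal (1 / (1 - exp (-(δ ^ 2 / 2)))) * ENNReal.ofReal (exp (δ * w - δ ^ 2 * T))

lemma isPotential_initialPlay (K : ℕ) :
    IsPotential (initialPlayCost K) (initialPlayPotential K) where
  measurable_cost _ := measurable_const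
  measurable _ := measurable_const
  cost_add_mean_le T w := by
    simp only [initialPlayCost, initialPlayPotential, lintegral_const, measure_univ, mul_one]
    split_ifs with hT
    · rw [show K - T = 1 + (K - (T + 1)) by omega, Nat.cast_add, Nat.cast_one]
    · rw [zero_add]
      exact_mod_cast Nat.sub_le_sub_left T.le_succ K

section Excess

variable {δ : ℝ}

lemma exp_neg_half_sq_lt_one (hδ : 0 < δ) : exp (-(δ ^ 2 / 2)) < 1 :=
  exp_lt_one_iff.2 (neg_lt_zero.2 (by positivity))

lemma excessCost_add_le (hδ : 0 < δ) (T : ℕ) (w : ℝ) :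
    excessCost δ T w + ENNReal.ofReal (exp (-(δ ^ 2 / 2))) * excessPotential δ T w
      ≤ excessPotential δ T w := by
  have hdecay := exp_neg_half_sq_lt_one hδ
  unfold excessPotential
  set q := exp (-(δ ^ 2 / 2))
  set E := exp (δ * w - δ ^ 2 * T)
  have hpos : 0 < 1 - q := sub_pos.2 hdecay
  have hcost : excessCost δ T w ≤ ENNReal.ofReal E := by
    unfold excessCost
    split_ifs with hw
    · exact ENNReal.one_le_ofReal.2 (one_le_exp (by nlinarith))
    · exact zero_le
  calc excessCost δ T w + ENNReal.ofReal q * (ENNReal.ofReal (1 / (1 - q)) * ENNReal.ofReal E)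
      ≤ ENNReal.ofReal E + ENNReal.ofReal q * (ENNReal.ofReal (1 / (1 - q)) * ENNReal.ofReal E) :=
        add_le_add_left hcost _
    _ = ENNReal.ofReal (1 / (1 - q)) * ENNReal.ofReal E := by
        have : 0 ≤ q := (exp_pos _).le
        have : 0 ≤ E := (exp_pos _).le
        rw [← ENNReal.ofReal_mul (by positivity), ← ENNReal.ofReal_mul (by positivity),
          ← ENNReal.ofReal_add (by positivity) (by positivity)]
        congr 1
        field_simp
        ring

lemma isPotential_excess (hδ : 0 < δ) : IsPotential (excessCost δ) (excessPotential δ) where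
  measurable_cost _ :=
    .ite (measurableSet_le measurable_const measurable_id) measurable_const measurable_const
  measurable _ := by
    unfold excessPotential
    fun_prop
  cost_add_mean_le T w := by
    refine le_of_eq_of_le ?_ (excessCost_add_le hδ T w)
    simp only [excessPotential]
    rw [lintegral_const_mul _ (by fun_prop), lintegral_exp_walk, mul_left_comm,
      show δ ^ 2 / 2 - δ ^ 2 = -(δ ^ 2 / 2) by ring]

lemma excessPotential_zero_le (hδ : 0 < δ) :
    excessPotential δ 0 0 ≤ ENNReal.ofReal (1 + 2 / δ ^ 2) := by
  have hpos : 0 < 1 - exp (-(δ ^ 2 / 2)) := sub_pos.2 (exp_neg_half_sq_lt_one hδ)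
  have hexp : exp (-(δ ^ 2 / 2)) * (δ ^ 2 / 2 + 1) ≤ 1 := by
    rw [exp_neg, inv_mul_le_one₀ (exp_pos _)]
    exact add_one_le_exp _
  have hsum : 1 / (1 - exp (-(δ ^ 2 / 2))) ≤ 1 + 2 / δ ^ 2 := by
    rw [one_add_div (by positivity), div_le_div_iff₀ hpos (by positivity)]
    linarith
  simpa [excessPotential] using ENNReal.ofReal_le_ofReal hsum

end Excess

/-- The cost that pays for a play with too large an index: such a play is among the first `K` plays
of the arm, or else the empirical mean exceeds the mean by `δ`. -/
def playCost (K : ℕ) (δ : ℝ) : ℕ → ℝ → ENNReal := initialPlayCost K + excessCost δ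

/-- The potential for `playCost`. -/
def playPotential (K : ℕ) (δ : ℝ) : ℕ → ℝ → ENNReal :=
  initialPlayPotential K + excessPotential δ

lemma isPotential_play (K : ℕ) {δ : ℝ} (hδ : 0 < δ) :
    IsPotential (playCost K δ) (playPotential K δ) :=
  (isPotential_initialPlay K).add (isPotential_excess hδ)

lemma playPotential_zero_le (K : ℕ) {δ : ℝ} (hδ : 0 < δ) :
    playPotential K δ 0 0 ≤ ENNReal.ofReal (K + (1 + 2 / δ ^ 2)) := by
  rw [ENNReal.ofReal_add (by positivity) (by positivity), ENNReal.ofReal_natCast]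
  exact add_le_add_right (excessPotential_zero_le hδ) _

lemma gittinsIndex_inv_le (ν : ℝ) {T m : ℕ} {x : ℝ} (hT : 1 ≤ T) (hm : 1 ≤ m) (hx : 1 ≤ x)
    (hmx : (m : ℝ) ≤ exp (x ^ 2 / 2)) : gittinsIndex ν (T : ℝ≥0)⁻¹ m ≤ ν + x / √T := by
  have hindex := gittinsIndex_le (ν := ν) hm (inv_pos.2 (sqrt_natCast_pos hT)) hx hmx
  rwa [← natCast_inv_eq_sq, NNReal.coe_inv, Real.coe_sqrt, NNReal.coe_natCast,
    inv_mul_eq_div] at hindex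

lemma gittinsIndex_inv_le_add {ν δ : ℝ} {T m n : ℕ} (hδ : 0 < δ) (hT : 1 ≤ T) (hm : 1 ≤ m)
    (hmn : m ≤ n) (hlog : 1 ≤ log n) (hlarge : 6 * log n / δ ^ 2 ≤ T) :
    gittinsIndex ν (T : ℝ≥0)⁻¹ m ≤ ν + δ := by
  have hn : (0 : ℝ) < n := by exact_mod_cast hm.trans hmn
  have hT0 : (0 : ℝ) < T := by exact_mod_cast hT
  set x := √(2 * log n) + 1
  have hsqrt_nonneg : 0 ≤ √(2 * log n) := sqrt_nonneg _
  have hsq : √(2 * log n) ^ 2 = 2 * log n := sq_sqrt (by linarith)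
  have hmx : (m : ℝ) ≤ exp (x ^ 2 / 2) :=
    calc (m : ℝ) ≤ n := by exact_mod_cast hmn
      _ = exp (log n) := (exp_log hn).symm
      _ ≤ exp (x ^ 2 / 2) := exp_le_exp.2 (by nlinarith)
  have hx_sq : x ^ 2 ≤ 6 * log n := by nlinarith [sq_nonneg (√(2 * log n) - 1)]
  have hwidth : x / √T ≤ δ := by
    rw [div_le_iff₀ (sqrt_pos.2 hT0)]
    refine le_of_sq_le_sq ?_ (by positivity)
    rw [mul_pow, sq_sqrt hT0.le, mul_comm]
    exact hx_sq.trans ((div_le_iff₀ (by positivity)).1 hlarge)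
  exact (gittinsIndex_inv_le ν hT hm (by linarith) hmx).trans (add_le_add_right hwidth ν)

lemma one_le_playCost {μ δ w : ℝ} {T m n : ℕ} (hδ : 0 < δ) (hT : 1 ≤ T) (hm : 1 ≤ m) (hmn : m ≤ n)
    (hlog : 1 ≤ log n) (hindex : μ + 2 * δ ≤ gittinsIndex (μ + w / T) (T : ℝ≥0)⁻¹ m) :
    1 ≤ playCost ⌈6 * log n / δ ^ 2⌉₊ δ T w := by
  rcases lt_or_ge T ⌈6 * log n / δ ^ 2⌉₊ with hfew | hmany
  · exact le_add_right (if_pos hfew).ge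
  · have hupper := gittinsIndex_inv_le_add (ν := μ + w / T) hδ hT hm hmn hlog (Nat.ceil_le.1 hmany)
    have hexcess : T * δ ≤ w := by
      rw [← le_div_iff₀' (by exact_mod_cast hT)]
      linarith
    exact le_add_left (if_pos hexcess).ge

/-! ### The number of plays of a suboptimal arm -/

lemma gap_nonneg (μ : Fin d → ℝ) (i : Fin d) : 0 ≤ gap μ i :=
  sub_nonneg.2 (le_ciSup (finite_range μ).bddAbove i)

lemma exists_eq_add_gap (μ : Fin d → ℝ) (i : Fin d) : ∃ j, μ j = μ i + gap μ i := by
  have : Nonempty (Fin d) := ⟨i⟩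
  obtain ⟨j, hj⟩ := exists_eq_ciSup_of_finite (f := μ)
  exact ⟨j, hj.trans (add_sub_cancel (μ i) (optMean μ)).symm⟩

lemma one_le_log_of_gap_pos {μ : Fin d → ℝ} {i : Fin d} {n : ℕ} (hi : 0 < gap μ i) (hdn : d < n) :
    1 ≤ log n := by
  obtain ⟨j, hj⟩ := exists_eq_add_gap μ i
  have : Nontrivial (Fin d) := ⟨i, j, by rintro rfl; linarith⟩
  have hd : 2 ≤ d := Fin.nontrivial_iff_two_le.1 this
  have hn : (3 : ℝ) ≤ n := by exact_mod_cast (by omega : 3 ≤ n)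
  rw [le_log_iff_exp_le (by linarith)]
  linarith [exp_one_lt_d9]

lemma sum_inv_sub_le (d n : ℕ) :
    ∑ t ∈ Finset.Ico d n, ((n - t : ℕ) : ℝ)⁻¹ ≤ 1 + log n := by
  calc ∑ t ∈ Finset.Ico d n, ((n - t : ℕ) : ℝ)⁻¹
      ≤ ∑ t ∈ Finset.range n, ((n - t : ℕ) : ℝ)⁻¹ :=
        Finset.sum_le_sum_of_subset_of_nonneg
          (fun t ht => Finset.mem_range.2 (Finset.mem_Ico.1 ht).2) fun _ _ _ => by positivity
    _ = ∑ t ∈ Finset.range n, ((t + 1 : ℕ) : ℝ)⁻¹ := by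
        rw [← Finset.sum_range_reflect]
        refine Finset.sum_congr rfl fun t ht => ?_
        rw [show n - (n - 1 - t) = t + 1 by have := Finset.mem_range.1 ht; omega]
    _ = harmonic n := by
        rw [harmonic]
        push_cast
        rfl
    _ ≤ 1 + log n := harmonic_le_one_add_log n

section Plays

variable {μ : Fin d → ℝ} {n t : ℕ} {I : ℕ → Ω → Fin d} {X : ℕ → Ω → ℝ} {i j : Fin d} {Δ : ℝ}

lemma one_le_potential_add_playCost {V : ℕ → ℝ → ENNReal} {ω : Ω}
    (hV : ∀ (ν : ℝ) (T : ℕ) (w : ℝ), 1 ≤ T →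
      gittinsIndex (ν - w / T) (T : ℝ≥0)⁻¹ (n - t) < ν - Δ / 2 → 1 ≤ V T w)
    (hΔ : 0 < Δ) (hμ : μ j = μ i + Δ) (ht : t < n) (hlog : 1 ≤ log n)
    (hi : 1 ≤ armCount I i t ω) (hj : 1 ≤ armCount I j t ω)
    (hindex : flatIndex n I X j t ω ≤ flatIndex n I X i t ω) :
    1 ≤ V (armCount I j t ω) (armWalk (-1) μ I X j t ω)
      + playCost ⌈6 * log n / (Δ / 4) ^ 2⌉₊ (Δ / 4) (armCount I i t ω)
          (armWalk 1 μ I X i t ω) := by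
  unfold flatIndex at hindex
  rw [empMean_eq_add_armWalk_div (e := -1) (by norm_num) μ hj,
    empMean_eq_add_armWalk_div (one_pow 2) μ hi, neg_one_mul, ← sub_eq_add_neg, one_mul] at hindex
  rcases lt_or_ge (gittinsIndex (μ j - armWalk (-1) μ I X j t ω / armCount I j t ω)
    (armCount I j t ω : ℝ≥0)⁻¹ (n - t)) (μ j - Δ / 2) with hsmall | hlarge
  · exact le_add_right (hV (μ j) _ _ hj hsmall)
  · exact le_add_left (one_le_playCost (μ := μ i) (by positivity) hi (by omega) (n.sub_le t) hlog
      (by linarith))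

variable [MeasurableSpace Ω] {P : Measure Ω} [IsProbabilityMeasure P]

lemma measure_arm_eq_le (h : IsInteraction P μ n I X) (hF : FollowsFlatGittins P n I X)
    (hΔ : 0 < Δ) (hμ : μ j = μ i + Δ) (hlog : 1 ≤ log n) (ht : t ∈ Finset.Ico d n) :
    P {ω | I t ω = i} ≤ ENNReal.ofReal (indexFailureConst / ((n - t : ℕ) * (Δ / 2) ^ 2))
      + ∫⁻ ω in {ω | I t ω = i}, playCost ⌈6 * log n / (Δ / 4) ^ 2⌉₊ (Δ / 4) (armCount I i t ω)
          (armWalk 1 μ I X i t ω) ∂P := by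
  obtain ⟨hdt, htn⟩ := Finset.mem_Ico.1 ht
  obtain ⟨V, hV, hV_zero, hV_one⟩ := exists_isSuperharmonic_one_le_of_gittinsIndex_lt
    (m := n - t) (ε := Δ / 2) (by omega) (by positivity)
  have hV_mean : ∫⁻ ω, V (armCount I j t ω) (armWalk (-1) μ I X j t ω) ∂P ≤ V 0 0 :=
    le_add_self.trans
      (h.sum_setLIntegral_cost_add_lintegral_potential_le j (by norm_num) hV htn.le)
  have hpointwise : ∀ᵐ ω ∂P, ω ∈ {ω | I t ω = i} →
      1 ≤ V (armCount I j t ω) (armWalk (-1) μ I X j t ω)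
        + playCost ⌈6 * log n / (Δ / 4) ^ 2⌉₊ (Δ / 4) (armCount I i t ω)
            (armWalk 1 μ I X i t ω) := by
    filter_upwards [hF] with ω hω (hi : I t ω = i)
    have hcount := one_le_armCount (I := I) hdt fun s hs => (hω s (by omega)).1 hs
    exact one_le_potential_add_playCost hV_one hΔ hμ htn hlog (hcount i) (hcount j)
      (hi ▸ (hω t htn).2 hdt j)
  rw [← setLIntegral_one]
  refine (setLIntegral_mono_ae' (h.measurableSet_arm_eq t i) hpointwise).trans ?_
  rw [lintegral_add_left (h.measurable_potential hV.measurable (-1) j t)]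
  exact add_le_add_left (((setLIntegral_le_lintegral _ _).trans hV_mean).trans hV_zero) _

lemma sum_initial_plays_le (hF : FollowsFlatGittins P n I X) (i : Fin d) :
    ∑ t ∈ Finset.range n with t < d, P {ω | I t ω = i} ≤ 1 := by
  have hround (t : ℕ) (ht : t ∈ {t ∈ Finset.range n | t < d}) :
      P {ω | I t ω = i} ≤ if t = (i : ℕ) then 1 else 0 := by
    obtain ⟨htn, htd⟩ := Finset.mem_filter.1 ht
    split_ifs with hti
    · exact prob_le_one
    · refine (measure_eq_zero_iff_ae_notMem.2 ?_).le
      filter_upwards [hF] with ω hω (hi : I t ω = i)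
      exact hti (by rw [← hi, (hω t (Finset.mem_range.1 htn)).1 htd])
  refine (Finset.sum_le_sum hround).trans ?_
  rw [Finset.sum_ite_eq']
  split_ifs <;> simp

lemma sum_later_plays_le_add (h : IsInteraction P μ n I X) (hF : FollowsFlatGittins P n I X)
    (hΔ : 0 < Δ) (hμ : μ j = μ i + Δ) (hlog : 1 ≤ log n) :
    ∑ t ∈ Finset.Ico d n, P {ω | I t ω = i}
      ≤ ENNReal.ofReal (∑ t ∈ Finset.Ico d n, indexFailureConst / ((n - t : ℕ) * (Δ / 2) ^ 2)
        + (⌈6 * log n / (Δ / 4) ^ 2⌉₊ + (1 + 2 / (Δ / 4) ^ 2))) := by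
  have := indexFailureConst_pos
  have hδ : 0 < Δ / 4 := by positivity
  have hplay := isPotential_play ⌈6 * log n / (Δ / 4) ^ 2⌉₊ hδ
  have hcost := h.sum_setLIntegral_cost_add_lintegral_potential_le i (one_pow 2) hplay le_rfl
  refine (Finset.sum_le_sum fun t ht => measure_arm_eq_le h hF hΔ hμ hlog ht).trans ?_
  rw [Finset.sum_add_distrib, ENNReal.ofReal_add (Finset.sum_nonneg fun _ _ => by positivity)
    (by positivity), ENNReal.ofReal_sum_of_nonneg fun _ _ => by positivity]
  have hsubset : Finset.Ico d n ⊆ Finset.range n := fun t ht =>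
    Finset.mem_range.2 (Finset.mem_Ico.1 ht).2
  exact add_le_add_right ((Finset.sum_le_sum_of_subset hsubset).trans
    (le_self_add.trans (hcost.trans (playPotential_zero_le _ hδ)))) _

/-- The constant in the logarithmic bound on the number of plays of a suboptimal arm. -/
def playsConst : ℝ := 8 * indexFailureConst + 128

lemma three_le_playsConst : 3 ≤ playsConst := by
  unfold playsConst
  linarith [indexFailureConst_pos]

lemma sum_later_plays_le (h : IsInteraction P μ n I X) (hF : FollowsFlatGittins P n I X)
    (hΔ : 0 < Δ) (hμ : μ j = μ i + Δ) (hlog : 1 ≤ log n) :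
    ∑ t ∈ Finset.Ico d n, P {ω | I t ω = i} ≤ ENNReal.ofReal (2 + playsConst * log n / Δ ^ 2) := by
  refine (sum_later_plays_le_add h hF hΔ hμ hlog).trans (ENNReal.ofReal_le_ofReal ?_)
  have := indexFailureConst_pos
  have hfailure : ∑ t ∈ Finset.Ico d n, indexFailureConst / ((n - t : ℕ) * (Δ / 2) ^ 2)
      ≤ 8 * indexFailureConst * log n / Δ ^ 2 :=
    calc ∑ t ∈ Finset.Ico d n, indexFailureConst / ((n - t : ℕ) * (Δ / 2) ^ 2)
        = 4 * indexFailureConst / Δ ^ 2 * ∑ t ∈ Finset.Ico d n, ((n - t : ℕ) : ℝ)⁻¹ := by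
          rw [Finset.mul_sum]
          refine Finset.sum_congr rfl fun t _ => ?_
          rw [div_pow, mul_comm ((n - t : ℕ) : ℝ), ← div_div, div_div_eq_mul_div,
            div_eq_mul_inv _ ((n - t : ℕ) : ℝ)]
          ring
      _ ≤ 4 * indexFailureConst / Δ ^ 2 * (2 * log n) := by
          gcongr
          linarith [sum_inv_sub_le d n]
      _ = 8 * indexFailureConst * log n / Δ ^ 2 := by ring
  have hceil : (⌈6 * log n / (Δ / 4) ^ 2⌉₊ : ℝ) ≤ 96 * log n / Δ ^ 2 + 1 := by
    refine (Nat.ceil_lt_add_one (by positivity)).le.trans_eq ?_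
    rw [div_pow, div_div_eq_mul_div]
    ring
  have hexcess : 2 / (Δ / 4) ^ 2 ≤ 32 * log n / Δ ^ 2 := by
    rw [div_pow, div_div_eq_mul_div]
    exact div_le_div_of_nonneg_right (by linarith) (by positivity)
  have hsplit : playsConst * log n / Δ ^ 2 = 8 * indexFailureConst * log n / Δ ^ 2
      + 96 * log n / Δ ^ 2 + 32 * log n / Δ ^ 2 := by
    unfold playsConst
    ring
  linarith

/-- The expected number of plays of an arm. -/
def expectedPlays (P : Measure Ω) (n : ℕ) (I : ℕ → Ω → Fin d) (i : Fin d) : ℝ :=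
  ∑ t ∈ Finset.range n, P.real {ω | I t ω = i}

lemma expectedPlays_nonneg (P : Measure Ω) (n : ℕ) (I : ℕ → Ω → Fin d) (i : Fin d) :
    0 ≤ expectedPlays P n I i :=
  Finset.sum_nonneg fun _ _ => measureReal_nonneg

lemma expectedPlays_le (h : IsInteraction P μ n I X) (hF : FollowsFlatGittins P n I X)
    (hi : 0 < gap μ i) : expectedPlays P n I i ≤ 3 + playsConst * log n / gap μ i ^ 2 := by
  have := three_le_playsConst
  have : 0 ≤ log n := log_natCast_nonneg n
  have hlater : ∑ t ∈ Finset.Ico d n, P {ω | I t ω = i}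
      ≤ ENNReal.ofReal (2 + playsConst * log n / gap μ i ^ 2) := by
    rcases le_or_gt n d with hnd | hdn
    · rw [Finset.Ico_eq_empty_of_le hnd, Finset.sum_empty]
      exact zero_le
    · obtain ⟨j, hj⟩ := exists_eq_add_gap μ i
      exact sum_later_plays_le h hF hi hj (one_le_log_of_gap_pos hi hdn)
  have hrounds : {t ∈ Finset.range n | ¬ t < d} = Finset.Ico d n := by
    ext t
    simp [and_comm]
  have htotal : ∑ t ∈ Finset.range n, P {ω | I t ω = i}
      ≤ ENNReal.ofReal (3 + playsConst * log n / gap μ i ^ 2) := by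
    rw [← Finset.sum_filter_add_sum_filter_not (Finset.range n) (· < d), hrounds]
    refine (add_le_add (sum_initial_plays_le hF i) hlater).trans_eq ?_
    rw [← ENNReal.ofReal_one, ← ENNReal.ofReal_add zero_le_one (by positivity), ← add_assoc]
    norm_num
  have hreal := ENNReal.toReal_le_of_le_ofReal (by positivity) htotal
  rwa [ENNReal.toReal_sum fun t _ => measure_ne_top P _] at hreal

lemma gap_mul_expectedPlays_le (h : IsInteraction P μ n I X) (hF : FollowsFlatGittins P n I X)
    (hi : 0 < gap μ i) :
    gap μ i * expectedPlays P n I i ≤ playsConst * (log n / gap μ i + gap μ i) := by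
  calc gap μ i * expectedPlays P n I i
      ≤ gap μ i * (3 + playsConst * log n / gap μ i ^ 2) := by
        gcongr
        exact expectedPlays_le h hF hi
    _ = 3 * gap μ i + playsConst * (log n / gap μ i) := by field_simp
    _ ≤ playsConst * gap μ i + playsConst * (log n / gap μ i) := by
        gcongr
        exact three_le_playsConst
    _ = playsConst * (log n / gap μ i + gap μ i) := by ring

end Plays

/-! ### The regret -/

lemma sub_arm_eq_sum (μ : Fin d → ℝ) (I : ℕ → Ω → Fin d) (t : ℕ) (ω : Ω) :
    optMean μ - μ (I t ω) = ∑ i, gap μ i * {ω | I t ω = i}.indicator 1 ω := by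
  classical
  simp [gap, indicator_apply]

section Regret

variable [MeasurableSpace Ω] {P : Measure Ω} [IsProbabilityMeasure P] {μ : Fin d → ℝ} {n : ℕ}
  {I : ℕ → Ω → Fin d} {X : ℕ → Ω → ℝ}

lemma regret_eq_sum (h : IsInteraction P μ n I X) :
    regret P μ n I = ∑ i, gap μ i * expectedPlays P n I i := by
  have hint (t : ℕ) (i : Fin d) :
      Integrable (fun ω => gap μ i * {ω | I t ω = i}.indicator (1 : Ω → ℝ) ω) P :=
    ((integrable_const (1 : ℝ)).indicator (h.measurableSet_arm_eq t i)).const_mul _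
  simp only [regret, sub_arm_eq_sum, expectedPlays, Finset.mul_sum]
  rw [integral_finsetSum _ fun t _ => integrable_finsetSum _ fun i _ => hint t i, Finset.sum_comm]
  refine Finset.sum_congr rfl fun t _ => ?_
  rw [integral_finsetSum _ fun i _ => hint t i]
  refine Finset.sum_congr rfl fun i _ => ?_
  rw [integral_const_mul, integral_indicator_one (h.measurableSet_arm_eq t i)]

lemma sum_expectedPlays (h : IsInteraction P μ n I X) : ∑ i, expectedPlays P n I i = n := by
  have hround (t : ℕ) : ∑ i, P.real {ω | I t ω = i} = 1 := by
    simpa [preimage] using sum_measureReal_preimage_singleton (μ := P) (f := I t) Finset.univ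
      fun i _ => h.measurableSet_arm_eq t i
  simp only [expectedPlays]
  rw [Finset.sum_comm]
  simp [hround]

end Regret

section RegretBounds

variable {ι : Type*} [Fintype ι] {Δ N : ι → ℝ} {C ℓ : ℝ}

lemma sum_mul_le_sum_filter (hΔ : ∀ i, 0 ≤ Δ i)
    (hN : ∀ i, 0 < Δ i → Δ i * N i ≤ C * (ℓ / Δ i + Δ i)) :
    ∑ i, Δ i * N i ≤ C * ∑ i with 0 < Δ i, (ℓ / Δ i + Δ i) := by
  rw [Finset.mul_sum, Finset.sum_filter]
  refine Finset.sum_le_sum fun i _ => ?_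
  split_ifs with hi
  · exact hN i hi
  · rw [le_antisymm (not_lt.1 hi) (hΔ i), zero_mul]

-- With `a = Δ N`, the hypothesis says that `a ^ 2 ≤ C ℓ N + C Δ a`.
lemma mul_le_sqrt_add {Δ N : ℝ} (hC : 1 ≤ C) (hℓ : 0 ≤ ℓ) (hΔ : 0 ≤ Δ) (hN_nonneg : 0 ≤ N)
    (hN : 0 < Δ → Δ * N ≤ C * (ℓ / Δ + Δ)) : Δ * N ≤ C * (√ℓ * √N) + C * Δ := by
  have : 0 ≤ √ℓ * √N := by positivity
  have hroot_sq : (√ℓ * √N) ^ 2 = ℓ * N := by rw [mul_pow, sq_sqrt hℓ, sq_sqrt hN_nonneg]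
  rcases hΔ.eq_or_lt with rfl | hpos
  · rw [zero_mul]
    positivity
  by_contra! hlt
  have hquad : Δ * N * (Δ * N - C * Δ) ≤ C * (ℓ * N) := by
    have hmul := mul_le_mul_of_nonneg_right (hN hpos) (mul_nonneg hN_nonneg hpos.le)
    have hcancel : C * (ℓ / Δ + Δ) * (N * Δ) = C * (ℓ * N) + C * Δ * (Δ * N) := by field_simp
    linarith
  have hlarge : C * (√ℓ * √N) * (C * (√ℓ * √N)) < Δ * N * (Δ * N - C * Δ) :=
    mul_lt_mul'' (by nlinarith) (by linarith) (by positivity) (by positivity)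
  have hroot_mul : C * (√ℓ * √N) * (C * (√ℓ * √N)) = C * (C * (ℓ * N)) := by
    rw [← hroot_sq]
    ring
  linarith [mul_le_mul_of_nonneg_right hC (by positivity : 0 ≤ C * (ℓ * N))]

lemma sum_mul_le_sqrt_add (hC : 1 ≤ C) (hℓ : 0 ≤ ℓ) (hΔ : ∀ i, 0 ≤ Δ i) (hN_nonneg : ∀ i, 0 ≤ N i)
    (hN : ∀ i, 0 < Δ i → Δ i * N i ≤ C * (ℓ / Δ i + Δ i)) :
    ∑ i, Δ i * N i ≤ C * (√(Fintype.card ι * (∑ i, N i) * ℓ) + ∑ i, Δ i) := by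
  calc ∑ i, Δ i * N i ≤ ∑ i, (C * (√ℓ * √(N i)) + C * Δ i) :=
        Finset.sum_le_sum fun i _ => mul_le_sqrt_add hC hℓ (hΔ i) (hN_nonneg i) (hN i)
    _ = C * (∑ i, √ℓ * √(N i) + ∑ i, Δ i) := by
        rw [mul_add, Finset.mul_sum, Finset.mul_sum, Finset.sum_add_distrib]
    _ ≤ C * (√(∑ _i : ι, ℓ) * √(∑ i, N i) + ∑ i, Δ i) := by
        gcongr
        exact sum_sqrt_mul_sqrt_le Finset.univ (fun _ => hℓ) hN_nonneg
    _ = C * (√(Fintype.card ι * (∑ i, N i) * ℓ) + ∑ i, Δ i) := by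
        rw [← sqrt_mul (Finset.sum_nonneg fun _ _ => hℓ), Finset.sum_const, nsmul_eq_mul,
          Finset.card_univ, mul_right_comm]

end RegretBounds

end GittinsBandit

end

theorem theorem2 :
    ∃ c c' : ℝ, 0 < c ∧ 0 < c' ∧
      ∀ (d n : ℕ) (μ : Fin d → ℝ) (Ω : Type*) [MeasurableSpace Ω] (P : Measure Ω)
        [IsProbabilityMeasure P] (I : ℕ → Ω → Fin d) (X : ℕ → Ω → ℝ),
        GittinsBandit.IsInteraction P μ n I X →
        GittinsBandit.FollowsFlatGittins P n I X →
        GittinsBandit.regret P μ n I ≤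
            c * ∑ i with 0 < GittinsBandit.gap μ i,
              (Real.log n / GittinsBandit.gap μ i + GittinsBandit.gap μ i) ∧
          GittinsBandit.regret P μ n I ≤
            c' * (√(d * n * Real.log n) + ∑ i, GittinsBandit.gap μ i) := by
  have hconst := GittinsBandit.three_le_playsConst
  refine ⟨GittinsBandit.playsConst, GittinsBandit.playsConst, by linarith, by linarith,
    fun d n μ Ω _ P _ I X h hF => ?_⟩
  have hgap := GittinsBandit.gap_nonneg μ
  have hplays : ∀ i, 0 < GittinsBandit.gap μ i →
      GittinsBandit.gap μ i * GittinsBandit.expectedPlays P n I i ≤ GittinsBandit.playsConst *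
        (Real.log n / GittinsBandit.gap μ i + GittinsBandit.gap μ i) :=
    fun i hi => GittinsBandit.gap_mul_expectedPlays_le h hF hi
  rw [GittinsBandit.regret_eq_sum h]
  constructor
  · exact GittinsBandit.sum_mul_le_sum_filter hgap hplays
  · simpa only [GittinsBandit.sum_expectedPlays h, Fintype.card_fin] using
      GittinsBandit.sum_mul_le_sqrt_add (by linarith) (Real.log_natCast_nonneg n) hgap
        (GittinsBandit.expectedPlays_nonneg P n I) hplays
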